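/- **Setting.** Let $T>0$ and $\tfrac12<\alpha<1$. Let $(\Omega,\mathcal F,\mathbb P)$ be a probability space with a filtration $\mathbb F=(\mathcal F_t)_{t\in[0,T]}$ that is left-continuous, i.e. $\mathcal F_t=\sigma\big(\bigcup_{s<t}\mathcal F_s\big)$ for $t\in(0,T]$, and let $X=(X_t)_{t\in[0,T]}$ be an $\mathbb F$-adapted real-valued process. **The class $\mathcal X^\alpha_T$.** For a centered process $Y$ write $R_Y(s,t)=\mathbb E[Y_sY_t]$, $W_Y(t,s)=\mathbb E[(Y_t-Y_s)^2]$ and $V_Y(t)=\mathbb E[Y_t^2]$. We say $X\in\mathcal X^\alpha_T$ if $X$ is a centered Gaussian process with almost surely continuous paths and there is $\delta\in(0,T]$ such that for every $u\in[T-\delta,T)$ the process $Y_t=X_{t+u}-X_u$, $t\in[0,T-u]$, satisfies, with constants that may depend on $u$: 1. $R_Y(s,t)>0$ for all $s,t\in(0,T-u]$; 2. there is $C>0$ with $\sup_{0\le s\le T-u-t}W_Y(t+s,s)\le Ct^{2\alpha}$ for all $t\in[0,T-u]$; 3. there are $c,\hat\delta>0$ with $V_Y(s)\ge cs^2$ for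 all $s\in[0,T-u]$ with $s\le\hat\delta$; 4. there is $\hat\delta>0$ with $\sup_{0<t<2\hat\delta,\ t\le T-u}\ \sup_{t/2\le s\le t}R_Y(s,s)/R_Y(t,s)<\infty$. **Small ball assumption.** There are $C,\Delta_0>0$ and $\delta\in(0,T]$ such that for all $s<t$ in $[T-\delta,T]$ with $\Delta:=t-s\le\Delta_0$ and all $0<\varepsilon\le\Delta^\alpha$, $$\mathbb P\Big(\sup_{s\le u\le t}|X_u-X_s|\le\varepsilon\Big)\le\exp\big(-C\,\Delta\,\varepsilon^{-1/\alpha}\big).$$ **The integral.** For $\beta\in(0,1)$ and functions $f,g$ on $[0,t]$, the generalized Lebesgue–Stieltjes integral $\int_0^t f\,\mathrm dg$ is the Lebesgue integral $$\int_0^t f\,\mathrm dg=-\int_0^t (D^\beta_{0+}f)(s)\,\big(D^{1-\beta}_{t-}g_{t-}\big)(s)\,\mathrm ds,\qquad g_{t-}(s)=g(s)-g(t),$$ where $$(D^{\beta}_{0+}f)(s)=\tfrac1{\Gamma(1-\beta)}\Big(\tfrac{f(s)}{s^\beta}+\beta\int_0^s\tfrac{f(s)-f(u)}{(s-u)^{\beta+1}}\mathrm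 du\Big),\qquad (D^{\gamma}_{t-}h)(s)=\tfrac1{\Gamma(1-\gamma)}\Big(\tfrac{h(s)}{(t-s)^\gamma}+\gamma\int_s^t\tfrac{h(s)-h(u)}{(u-s)^{\gamma+1}}\mathrm du\Big).$$ It is said to exist (with parameter $\beta$) if this Lebesgue integral converges absolutely, $f$ is measurable with $$\|f\|_{t,\beta}=\int_0^t\tfrac{|f(s)|}{s^\beta}\mathrm ds+\int_0^t\!\int_0^s\tfrac{|f(s)-f(u)|}{(s-u)^{1+\beta}}\,\mathrm du\,\mathrm ds<\infty,$$ and there is $a\in[0,t]$ such that $f=0$ on $[0,a)$ and $g$ is measurable on $[a,t]$ with $$\sup_{a\le s<r\le t}\Big(\tfrac{|g(r)-g(s)|}{(r-s)^{1-\beta}}+\int_s^r\tfrac{|g(u)-g(s)|}{(u-s)^{2-\beta}}\mathrm du\Big)<\infty .$$ (On $(0,a)$ one has $D^\beta_{0+}f=0$, and the integrand there is taken to be $0$.) **Theorem 3.2.** Let $X\in\mathcal X^\alpha_T$ satisfy the small ball assumption. Then for every real-valued $\mathcal F_T$-measurable random variable $\xi$ there are an $\mathbb F$-adapted process $\Psi_T=(\Psi_T(t))_{t\in[0,T]}$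 and $\beta\in(0,1)$ such that, almost surely, the generalized Lebesgue–Stieltjes integral $\int_0^s\Psi_T(r)\,\mathrm dX_r$ exists with parameter $\beta$ for every $0\le s<T$, and $$\lim_{s\to T-}\int_0^s\Psi_T(r)\,\mathrm dX_r=\xi .$$ -/

import Mathlib

open MeasureTheory ProbabilityTheory Filter Topology Set

noncomputable section

namespace GaussRep

/-! ### Gaussian processes and the class `𝒳^α_T` -/

section Processes

variable {Ω : Type*} {m : MeasurableSpace Ω}

/-- The covariance function `R_Y(s, t) = E[Y_s Y_t]` of a centered process. -/
def covFun (μ : Measure Ω) (Y : ℝ → Ω → ℝ) (s t : ℝ) : ℝ :=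
  ∫ ω, Y s ω * Y t ω ∂μ

/-- The incremental variance `W_Y(t, s) = E[(Y_t - Y_s)²]`. -/
def incVar (μ : Measure Ω) (Y : ℝ → Ω → ℝ) (t s : ℝ) : ℝ :=
  ∫ ω, (Y t ω - Y s ω) ^ 2 ∂μ

/-- The variance `V_Y(t) = E[Y_t²]`. -/
def varFun (μ : Measure Ω) (Y : ℝ → Ω → ℝ) (t : ℝ) : ℝ :=
  ∫ ω, Y t ω ^ 2 ∂μ

/-- The worst case incremental variance `w*_Y(t) = sup_{0 ≤ s ≤ L - t} W_Y(t + s, s)` of a process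
on `[0, L]`, as an extended nonnegative real. -/
def worstIncVar (μ : Measure Ω) (Y : ℝ → Ω → ℝ) (L t : ℝ) : ENNReal :=
  ⨆ s ∈ Icc (0 : ℝ) (L - t), ENNReal.ofReal (incVar μ Y (t + s) s)

/-- The process `Y_t = X_{t + u} - X_u`. -/
def shiftedIncrement (X : ℝ → Ω → ℝ) (u : ℝ) (t : ℝ) (ω : Ω) : ℝ :=
  X (t + u) ω - X u ω

/-- The four covariance conditions on a process `Y` on the time interval `[0, L]`. -/
structure CovarianceConditions (μ : Measure Ω) (Y : ℝ → Ω → ℝ) (L α : ℝ) : Prop where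
  cov_pos : ∀ s ∈ Ioc (0 : ℝ) L, ∀ t ∈ Ioc (0 : ℝ) L, 0 < covFun μ Y s t
  worst_le : ∃ C : ℝ, 0 < C ∧ ∀ t ∈ Icc (0 : ℝ) L,
    worstIncVar μ Y L t ≤ ENNReal.ofReal (C * t ^ (2 * α))
  var_ge : ∃ c d : ℝ, 0 < c ∧ 0 < d ∧ ∀ s ∈ Icc (0 : ℝ) L, s ≤ d → c * s ^ 2 ≤ varFun μ Y s
  ratio_bdd : ∃ d M : ℝ, 0 < d ∧ ∀ t ∈ Ioc (0 : ℝ) L, t < 2 * d →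
    ∀ s ∈ Icc (t / 2) t, covFun μ Y s s / covFun μ Y t s ≤ M

/-- The class `𝒳^α_T`: centered continuous Gaussian processes on `[0, T]` such that for some
`δ ∈ (0, T]` and every `u ∈ [T - δ, T)` the process `X_{· + u} - X_u` on `[0, T - u]` satisfies the
covariance conditions. Only the values of `X` at times in `[0, T]` matter. -/
structure ClassX (μ : Measure Ω) (X : ℝ → Ω → ℝ) (α T : ℝ) : Prop where
  gaussian : IsGaussianProcess (fun t : Icc (0 : ℝ) T => X t) μ
  centered : ∀ t ∈ Icc (0 : ℝ) T, ∫ ω, X t ω ∂μ = 0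
  continuous_paths : ∀ᵐ ω ∂μ, ContinuousOn (fun t => X t ω) (Icc (0 : ℝ) T)
  increments : ∃ δ : ℝ, 0 < δ ∧ δ ≤ T ∧ ∀ u ∈ Ico (T - δ) T,
    CovarianceConditions μ (shiftedIncrement X u) (T - u) α

/-- The small ball assumption near `T`, where `Δ = t - s` is the length of the interval:
`P(sup_{s ≤ u ≤ t} |X_u - X_s| ≤ ε) ≤ exp(-C Δ ε^{-1/α})` whenever `ε ≤ Δ^α`, for all sufficiently
short intervals `[s, t]` close to `T`. -/
def SmallBall (μ : Measure Ω) (X : ℝ → Ω → ℝ) (α T : ℝ) : Prop :=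
  ∃ C δ Δ₀ : ℝ, 0 < C ∧ 0 < δ ∧ δ ≤ T ∧ 0 < Δ₀ ∧
    ∀ s ∈ Icc (T - δ) T, ∀ t ∈ Icc (T - δ) T, s < t → t - s ≤ Δ₀ →
      ∀ ε : ℝ, 0 < ε → ε ≤ (t - s) ^ α →
        μ {ω | ∀ u ∈ Icc s t, |X u ω - X s ω| ≤ ε} ≤
          ENNReal.ofReal (Real.exp (-(C * (t - s) * ε ^ (-(1 / α)))))

/-- Left continuity of a filtration on `[0, T]`: `ℱ_t = σ(⋃_{s < t} ℱ_s)` for `t ∈ (0, T]`. -/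
def LeftContinuous {T : ℝ} (𝓕 : Filtration (Icc (0 : ℝ) T) m) : Prop :=
  ∀ t : Icc (0 : ℝ) T, 0 < (t : ℝ) → 𝓕 t = ⨆ s ∈ Iio t, 𝓕 s

end Processes

/-! ### The generalized Lebesgue–Stieltjes integral -/

/-- The fractional Besov norm `‖g‖_{1,γ}` on the interval `[a, t]`. -/
def besovNormOne (γ a t : ℝ) (g : ℝ → ℝ) : ENNReal :=
  ⨆ (s : ℝ) (r : ℝ) (_ : a ≤ s) (_ : s < r) (_ : r ≤ t),
    (ENNReal.ofReal (|g r - g s| / (r - s) ^ γ) +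
      ∫⁻ u in Ioo s r, ENNReal.ofReal (|g u - g s| / (u - s) ^ (1 + γ)))

/-- The fractional Besov space `W^γ_1([a, t])`. -/
def MemBesovOne (γ a t : ℝ) (g : ℝ → ℝ) : Prop :=
  Measurable (fun s : Icc a t => g s) ∧ besovNormOne γ a t g < ⊤

/-- The fractional Besov norm `‖f‖_{t,β} = ‖f‖_{2,β}` on the interval `[0, t]`. -/
def besovNormTwo (β t : ℝ) (f : ℝ → ℝ) : ENNReal :=
  (∫⁻ s in Ioo 0 t, ENNReal.ofReal (|f s| / s ^ β)) +
    ∫⁻ s in Ioo 0 t, ∫⁻ u in Ioo 0 s, ENNReal.ofReal (|f s - f u| / (s - u) ^ (1 + β))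

/-- The fractional Besov space `W^β_2([0, t])`. -/
def MemBesovTwo (β t : ℝ) (f : ℝ → ℝ) : Prop :=
  Measurable (fun s : Icc (0 : ℝ) t => f s) ∧ besovNormTwo β t f < ⊤

/-- The Weyl representation of the left-sided fractional derivative `D^β_{0+} f`. -/
def weylLeft (β : ℝ) (f : ℝ → ℝ) (s : ℝ) : ℝ :=
  1 / Real.Gamma (1 - β) *
    (f s / s ^ β + β * ∫ u in Ioo 0 s, (f s - f u) / (s - u) ^ (β + 1))

/-- The Weyl representation of the right-sided fractional derivative `D^γ_{t-} g`, without its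
unimodular factor. -/
def weylRight (γ t : ℝ) (g : ℝ → ℝ) (s : ℝ) : ℝ :=
  1 / Real.Gamma (1 - γ) *
    (g s / (t - s) ^ γ + γ * ∫ u in Ioo s t, (g s - g u) / (u - s) ^ (γ + 1))

/-- The integrand `(D^β_{0+} f)(s) (D^{1-β}_{t-} g_{t-})(s)` with `g_{t-} = g - g(t)` (the integrator
is continuous). The unimodular factors of the fractional derivatives multiply to `-1`. -/
def glsIntegrand (β : ℝ) (f g : ℝ → ℝ) (t s : ℝ) : ℝ :=
  -(weylLeft β f s * weylRight (1 - β) t (fun r => g r - g t) s)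

/-- The generalized Lebesgue–Stieltjes integral `∫_0^t f dg`. -/
def glsIntegral (β : ℝ) (f g : ℝ → ℝ) (t : ℝ) : ℝ :=
  ∫ s in Ioo 0 t, glsIntegrand β f g t s

/-- Existence of the generalized Lebesgue–Stieltjes integral `∫_0^t f dg` with parameter `β`:
`f ∈ W^β_2([0, t])`, the defining Lebesgue integral converges absolutely, and
`g ∈ W^{1-β}_1([a, t])` for some `a ∈ [0, t]` such that `f` vanishes on `[0, a)` (no regularity of
the integrator is needed before the integrand starts, since `D^β_{0+} f = 0` on `(0, a)`; for
`a = 0` this is the usual requirement on `[0, t]`). -/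
structure GLSExists (β : ℝ) (f g : ℝ → ℝ) (t : ℝ) : Prop where
  integrand_mem : MemBesovTwo β t f
  integrator_mem : ∃ a ∈ Icc (0 : ℝ) t, (∀ s ∈ Ico (0 : ℝ) a, f s = 0) ∧ MemBesovOne (1 - β) a t g
  integrable : IntegrableOn (glsIntegrand β f g t) (Ioo 0 t)

end GaussRep

end

noncomputable section

namespace GaussRep

/-! ### Power kernels -/

/-! The integral can be steered. Fix times τ n increasing to T. Left-continuity of the filtration
and martingale convergence give random variables ζ n, known at time τ n, that converge almost surely
to ξ (`exists_adapted_tendsto_of_leftContinuous`). Let v n be the value of the integral at τ n. On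
[τ n, τ (n+1)) the integrand is (ζ n - v n) F n'(X_r - X_{τ n}), where F n is smooth with values in
[0, 1], vanishes at 0 and equals 1 outside (-ε n, ε n). By the chain rule the integral at a time s
of this window is v n + (ζ n - v n) F n(X_s - X_{τ n}), a convex combination of v n and ζ n; it
reaches ζ n at τ (n+1) as soon as the increment of X over the window has size at least ε n.

That increment is a nondegenerate Gaussian variable, so a deterministic ε n makes failure at most
2⁻ⁿ likely (`exists_measure_abs_lt_le`). By Borel–Cantelli, almost surely v (n+1) = ζ n from some n
on; hence v n converges to ξ, and so does everything in between
(`tendsto_glsIntegral_steeringIntegrand`).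

What remains is the chain rule for the generalized Lebesgue–Stieltjes integral. The variance bound
makes paths Hölder of some order lam > 1/2 near T (`ClassX.ae_holder`), so β = 1/2 satisfies both β
< lam and 1 - β < lam. For a C¹ integrator the two fractional derivatives become Abel integrals, and
Fubini with the Beta integral reduces the claim to ordinary calculus (`glsIntegral_of_hasDerivAt`).
A Hölder integrator is the limit of its Steklov averages, which satisfy the same bounds, so
dominated convergence applies (`hasGLSIntegral_comp`). -/

theorem integrableOn_sub_rpow {ρ : ℝ} (hρ : -1 < ρ) (x y : ℝ) :
    IntegrableOn (fun u => (u - x) ^ ρ) (Ioo x y) := by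
  rcases le_or_gt y x with h | h
  · simp [Ioo_eq_empty_of_le h]
  · rw [← intervalIntegrable_iff_integrableOn_Ioo_of_le h.le]
    have := (intervalIntegral.intervalIntegrable_rpow' (a := 0) (b := y - x) hρ).comp_sub_right x
    simpa using this

theorem integrableOn_sub_rpow' {ρ : ℝ} (hρ : -1 < ρ) (x y : ℝ) :
    IntegrableOn (fun u => (y - u) ^ ρ) (Ioo x y) := by
  rcases le_or_gt y x with h | h
  · simp [Ioo_eq_empty_of_le h]
  · rw [← intervalIntegrable_iff_integrableOn_Ioo_of_le h.le]
    have := (intervalIntegral.intervalIntegrable_rpow' (a := 0) (b := y - x) hρ).comp_sub_left y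
    simpa using this.symm

theorem setIntegral_Ioo_eq_intervalIntegral {x y : ℝ} (h : x ≤ y) (f : ℝ → ℝ) :
    ∫ u in Ioo x y, f u = ∫ u in x..y, f u := by
  rw [intervalIntegral.integral_of_le h, integral_Ioc_eq_integral_Ioo]

theorem setIntegral_sub_rpow {ρ : ℝ} (hρ : -1 < ρ) {x y : ℝ} (h : x ≤ y) :
    ∫ u in Ioo x y, (u - x) ^ ρ = (y - x) ^ (ρ + 1) / (ρ + 1) := by
  rw [setIntegral_Ioo_eq_intervalIntegral h,
    intervalIntegral.integral_comp_sub_right (fun u => u ^ ρ) x, integral_rpow (Or.inl hρ),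
    sub_self, Real.zero_rpow (by linarith), sub_zero]

theorem setIntegral_sub_rpow' {ρ : ℝ} (hρ : -1 < ρ) {x y : ℝ} (h : x ≤ y) :
    ∫ u in Ioo x y, (y - u) ^ ρ = (y - x) ^ (ρ + 1) / (ρ + 1) := by
  rw [setIntegral_Ioo_eq_intervalIntegral h,
    intervalIntegral.integral_comp_sub_left (fun u => u ^ ρ) y, integral_rpow (Or.inl hρ),
    sub_self, Real.zero_rpow (by linarith), sub_zero]

theorem integrableOn_abs_sub_rpow {ρ : ℝ} (hρ : -1 < ρ) {x a y : ℝ} (hxa : x ≤ a) (hay : a ≤ y) :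
    IntegrableOn (fun u => |u - a| ^ ρ) (Ioo x y) := by
  have h1 : IntegrableOn (fun u => |u - a| ^ ρ) (Ioo x a) := by
    refine (integrableOn_sub_rpow' hρ x a).congr_fun (fun u hu => ?_) measurableSet_Ioo
    simp only
    rw [abs_sub_comm, abs_of_pos (sub_pos.2 hu.2)]
  have h2 : IntegrableOn (fun u => |u - a| ^ ρ) (Ioo a y) := by
    refine (integrableOn_sub_rpow hρ a y).congr_fun (fun u hu => ?_) measurableSet_Ioo
    simp only
    rw [abs_of_pos (sub_pos.2 hu.1)]
  rw [← intervalIntegrable_iff_integrableOn_Ioo_of_le hxa] at h1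
  rw [← intervalIntegrable_iff_integrableOn_Ioo_of_le hay] at h2
  rw [← intervalIntegrable_iff_integrableOn_Ioo_of_le (hxa.trans hay)]
  exact h1.trans h2

/-- Cutting at the midpoint leaves one endpoint singularity in each half, where the other factor is
bounded. -/
theorem integrableOn_beta_kernel {β : ℝ} (hβ : 0 < β) (hβ' : β < 1) (r u : ℝ) :
    IntegrableOn (fun s => (s - r) ^ (-β) * (u - s) ^ (β - 1)) (Ioo r u) := by
  rcases le_or_gt u r with h | h
  · simp [Ioo_eq_empty_of_le h]
  have hm : r < (r + u) / 2 := by linarith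
  have hm' : (r + u) / 2 < u := by linarith
  have h1 : IntegrableOn (fun s => (s - r) ^ (-β) * (u - s) ^ (β - 1)) (Ioo r ((r + u) / 2)) := by
    have := (integrableOn_sub_rpow (ρ := -β) (by linarith) r ((r + u) / 2)).mul_const
      (((u - r) / 2) ^ (β - 1))
    refine Integrable.mono' this (by fun_prop) ?_
    filter_upwards [ae_restrict_mem measurableSet_Ioo] with s hs
    have h0 : 0 < s - r := sub_pos.2 hs.1
    have h00 : 0 < u - s := by linarith [hs.2]
    rw [Real.norm_of_nonneg (by positivity)]
    refine mul_le_mul_of_nonneg_left ?_ (by positivity)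
    exact Real.rpow_le_rpow_of_nonpos (by linarith) (by linarith [hs.2]) (by linarith)
  have h2 : IntegrableOn (fun s => (s - r) ^ (-β) * (u - s) ^ (β - 1)) (Ioo ((r + u) / 2) u) := by
    have := (integrableOn_sub_rpow' (ρ := β - 1) (by linarith) ((r + u) / 2) u).const_mul
      (((u - r) / 2) ^ (-β))
    refine Integrable.mono' this (by fun_prop) ?_
    filter_upwards [ae_restrict_mem measurableSet_Ioo] with s hs
    have h0 : 0 < s - r := by linarith [hs.1]
    have h00 : 0 < u - s := by linarith [hs.2]
    rw [Real.norm_of_nonneg (by positivity)]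
    refine mul_le_mul_of_nonneg_right ?_ (by positivity)
    exact Real.rpow_le_rpow_of_nonpos (by linarith) (by linarith [hs.1]) (by linarith)
  rw [← intervalIntegrable_iff_integrableOn_Ioo_of_le hm.le] at h1
  rw [← intervalIntegrable_iff_integrableOn_Ioo_of_le hm'.le] at h2
  rw [← intervalIntegrable_iff_integrableOn_Ioo_of_le h.le]
  exact h1.trans h2

/-- This is B(1 - β, β). The exponents sum to -1, so the length of the interval drops out; this
scale invariance is what makes the Abel kernels compose to a constant. -/
theorem setIntegral_beta_kernel {β : ℝ} (hβ : 0 < β) (hβ' : β < 1) {r u : ℝ} (h : r < u) :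
    ∫ s in Ioo r u, (s - r) ^ (-β) * (u - s) ^ (β - 1) = Real.Gamma (1 - β) * Real.Gamma β := by
  have e := Complex.betaIntegral_scaled ((1 - β : ℝ) : ℂ) (β : ℂ) (sub_pos.2 h)
  rw [Complex.betaIntegral_eq_Gamma_mul_div _ _ (by simpa using hβ') (by simpa using hβ)] at e
  have e1 : (((1 - β : ℝ) : ℂ) + (β : ℂ)) = 1 := by push_cast; ring
  rw [e1, Complex.Gamma_one, sub_self, Complex.cpow_zero, one_mul, div_one,
    Complex.Gamma_ofReal, Complex.Gamma_ofReal, ← Complex.ofReal_mul] at e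
  rw [setIntegral_Ioo_eq_intervalIntegral h.le]
  have e2 := intervalIntegral.integral_comp_sub_right (a := r) (b := u)
    (fun s => s ^ (-β) * (u - r - s) ^ (β - 1)) r
  rw [sub_self] at e2
  have e3 : ∀ x : ℝ, u - r - (x - r) = u - x := fun x => by ring
  simp only [e3] at e2
  rw [e2]
  apply Complex.ofReal_injective
  rw [← e, ← intervalIntegral.integral_ofReal]
  refine intervalIntegral.integral_congr_ae (ae_of_all _ fun x hx => ?_)
  rw [uIoc_of_le (by linarith)] at hx
  rw [Complex.ofReal_mul, Complex.ofReal_cpow hx.1.le, Complex.ofReal_cpow (by linarith [hx.2])]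
  push_cast
  congr 2
  ring

/-! ### Integration by parts against power kernels -/

/-- Integrate the derivative of (h u - h s)(u - s)^(-γ). The boundary term at s vanishes because h
is Lipschitz and γ < 1. This converts a Weyl derivative into an Abel integral of h'. -/
theorem setIntegral_deriv_mul_rpow {h h' : ℝ → ℝ} {s t γ L : ℝ} (hst : s < t)
    (hγ' : γ < 1) (hh : ∀ x, HasDerivAt h (h' x) x) (hm : Measurable h')
    (hL : ∀ x ∈ Icc s t, |h' x| ≤ L) :
    ∫ u in Ioo s t, h' u * (u - s) ^ (-γ) =
      (h t - h s) * (t - s) ^ (-γ) + γ * ∫ u in Ioo s t, (h u - h s) / (u - s) ^ (γ + 1) := by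
  have hlip : ∀ u ∈ Icc s t, |h u - h s| ≤ L * (u - s) := by
    intro u hu
    have := (convex_Icc s t).norm_image_sub_le_of_norm_hasDerivWithin_le (f := h) (f' := h')
      (C := L) (fun x _ => (hh x).hasDerivWithinAt) (fun x hx => hL x hx)
      (left_mem_Icc.2 hst.le) hu
    simpa [abs_of_nonneg (sub_nonneg.2 hu.1)] using this
  have hc : Continuous h := continuous_iff_continuousAt.2 fun x => (hh x).continuousAt
  have hmh := hc.measurable
  have i1 : IntegrableOn (fun u => h' u * (u - s) ^ (-γ)) (Ioo s t) := by
    have := (integrableOn_sub_rpow (ρ := -γ) (by linarith) s t).const_mul L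
    refine Integrable.mono' this (by fun_prop) ?_
    filter_upwards [ae_restrict_mem measurableSet_Ioo] with u hu
    have : 0 < u - s := sub_pos.2 hu.1
    rw [norm_mul, Real.norm_of_nonneg (by positivity : 0 ≤ (u - s) ^ (-γ)), Real.norm_eq_abs]
    gcongr
    exact hL u (Ioo_subset_Icc_self hu)
  have i2 : IntegrableOn (fun u => (h u - h s) / (u - s) ^ (γ + 1)) (Ioo s t) := by
    have := (integrableOn_sub_rpow (ρ := -γ) (by linarith) s t).const_mul L
    refine Integrable.mono' this (Measurable.aestronglyMeasurable (by fun_prop)) ?_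
    filter_upwards [ae_restrict_mem measurableSet_Ioo] with u hu
    have h0 : 0 < u - s := sub_pos.2 hu.1
    rw [norm_div, Real.norm_of_nonneg (by positivity : 0 ≤ (u - s) ^ (γ + 1)), Real.norm_eq_abs,
      div_le_iff₀ (by positivity), mul_assoc, ← Real.rpow_add h0]
    simpa using hlip u (Ioo_subset_Icc_self hu)
  have key : ∫ u in s..t, (h' u * (u - s) ^ (-γ) - γ * ((h u - h s) / (u - s) ^ (γ + 1))) =
      (h t - h s) * (t - s) ^ (-γ) - (h s - h s) * (s - s) ^ (-γ) := by
    refine intervalIntegral.integral_eq_sub_of_hasDerivAt_of_le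
      (f := fun u => (h u - h s) * (u - s) ^ (-γ)) hst.le ?_ ?_ ?_
    · intro u hu
      rcases hu.1.eq_or_lt with rfl | hsu
      · have : Tendsto (fun u => L * (u - s) ^ (1 - γ)) (𝓝[Icc s t] s) (𝓝 0) := by
          have : ContinuousAt (fun u => L * (u - s) ^ (1 - γ)) s := by
            refine continuousAt_const.mul (ContinuousAt.rpow_const (by fun_prop) ?_)
            right; linarith
          have := this.tendsto
          rw [sub_self, Real.zero_rpow (by linarith), mul_zero] at this
          exact this.mono_left nhdsWithin_le_nhds
        rw [ContinuousWithinAt, sub_self, zero_mul]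
        refine squeeze_zero_norm' ?_ this
        filter_upwards [self_mem_nhdsWithin] with u hu
        rcases hu.1.eq_or_lt with rfl | hsu
        · simp [Real.zero_rpow (by linarith : 1 - γ ≠ 0)]
        have h0 : 0 < u - s := sub_pos.2 hsu
        rw [norm_mul, Real.norm_of_nonneg (by positivity : 0 ≤ (u - s) ^ (-γ)),
          Real.norm_eq_abs, sub_eq_add_neg 1 γ, Real.rpow_add h0, Real.rpow_one, ← mul_assoc]
        gcongr
        exact hlip u hu
      · refine ContinuousAt.continuousWithinAt ?_
        refine ContinuousAt.mul (by fun_prop) (ContinuousAt.rpow_const (by fun_prop) ?_)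
        left; linarith
    · intro u hu
      have h0 : 0 < u - s := sub_pos.2 hu.1
      have d2 : HasDerivAt (fun u => (u - s) ^ (-γ)) (-γ * (u - s) ^ (-γ - 1)) u := by
        have := ((hasDerivAt_id u).sub_const s).rpow_const (p := -γ) (Or.inl h0.ne')
        simpa using this
      refine (((hh u).sub_const (h s)).mul d2).congr_deriv ?_
      have : (u - s) ^ (-γ - 1) = ((u - s) ^ (γ + 1))⁻¹ := by
        rw [← Real.rpow_neg h0.le]; congr 1; ring
      rw [this]; ring
    · rw [intervalIntegrable_iff_integrableOn_Ioo_of_le hst.le]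
      exact i1.sub (i2.const_mul γ)
  rw [← setIntegral_Ioo_eq_intervalIntegral hst.le, integral_sub i1 (i2.const_mul γ),
    integral_const_mul] at key
  linarith

/-- Mirror image of the previous identity, applied to x ↦ -h (-x) so that the reflected derivative
keeps its sign. -/
theorem setIntegral_deriv_mul_rpow' {h h' : ℝ → ℝ} {a s γ L : ℝ} (has : a < s)
    (hγ' : γ < 1) (hh : ∀ x, HasDerivAt h (h' x) x) (hm : Measurable h')
    (hL : ∀ x ∈ Icc a s, |h' x| ≤ L) :
    ∫ u in Ioo a s, h' u * (s - u) ^ (-γ) =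
      (h s - h a) * (s - a) ^ (-γ) + γ * ∫ u in Ioo a s, (h s - h u) / (s - u) ^ (γ + 1) := by
  have key := setIntegral_deriv_mul_rpow (h := fun x => -h (-x)) (h' := fun x => h' (-x))
    (neg_lt_neg has) hγ' (fun x => by
      have := ((hh (-x)).scomp x (hasDerivAt_neg x)).neg
      refine HasDerivAt.congr_deriv (f := fun x => -h (-x)) this ?_
      simp) (by fun_prop) (L := L)
    (fun x hx => hL _ ⟨by linarith [hx.2], by linarith [hx.1]⟩)
  rw [setIntegral_Ioo_eq_intervalIntegral (by linarith),
    setIntegral_Ioo_eq_intervalIntegral (by linarith)] at key ⊢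
  have e1 := intervalIntegral.integral_comp_neg (a := a) (b := s)
    (fun u => h' (-u) * (u - -s) ^ (-γ))
  have e2 := intervalIntegral.integral_comp_neg (a := a) (b := s)
    (fun u => (-h (-u) - -h (- -s)) / (u - -s) ^ (γ + 1))
  rw [← e1, ← e2] at key
  simp only [neg_neg, sub_neg_eq_add] at key
  have c1 : ∀ u, -u + s = s - u := fun u => by ring
  have c2 : ∀ u, -h u + h s = h s - h u := fun u => by ring
  simpa only [c1, c2] using key

/-! ### Bounds and convergence of the fractional derivatives -/

/-- The moving endpoint is absorbed into the indicator of a triangle, leaving a parameter integral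
over a fixed space. -/
theorem measurable_setIntegral_Ioo_left {k : ℝ → ℝ → ℝ} (hk : Measurable (Function.uncurry k))
    (b : ℝ) : Measurable fun s => ∫ u in Ioo b s, k s u := by
  have : (fun s => ∫ u in Ioo b s, k s u) =
      fun s => ∫ u, {p : ℝ × ℝ | b < p.2 ∧ p.2 < p.1}.indicator (Function.uncurry k) (s, u) := by
    ext s
    rw [← integral_indicator measurableSet_Ioo]
    rfl
  rw [this]
  have hS : MeasurableSet {p : ℝ × ℝ | b < p.2 ∧ p.2 < p.1} :=
    (measurableSet_lt measurable_const measurable_snd).inter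
      (measurableSet_lt measurable_snd measurable_fst)
  exact (StronglyMeasurable.integral_prod_right
    (f := fun s u => {p : ℝ × ℝ | b < p.2 ∧ p.2 < p.1}.indicator (Function.uncurry k) (s, u))
    (hk.indicator hS).stronglyMeasurable).measurable

theorem measurable_setIntegral_Ioo_right {k : ℝ → ℝ → ℝ} (hk : Measurable (Function.uncurry k))
    (b : ℝ) : Measurable fun s => ∫ u in Ioo s b, k s u := by
  have : (fun s => ∫ u in Ioo s b, k s u) =
      fun s => ∫ u, {p : ℝ × ℝ | p.1 < p.2 ∧ p.2 < b}.indicator (Function.uncurry k) (s, u) := by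
    ext s
    rw [← integral_indicator measurableSet_Ioo]
    rfl
  rw [this]
  have hS : MeasurableSet {p : ℝ × ℝ | p.1 < p.2 ∧ p.2 < b} :=
    (measurableSet_lt measurable_fst measurable_snd).inter
      (measurableSet_lt measurable_snd measurable_const)
  exact (StronglyMeasurable.integral_prod_right
    (f := fun s u => {p : ℝ × ℝ | p.1 < p.2 ∧ p.2 < b}.indicator (Function.uncurry k) (s, u))
    (hk.indicator hS).stronglyMeasurable).measurable

theorem measurable_setLIntegral_Ioo_left {k : ℝ → ℝ → ENNReal}
    (hk : Measurable (Function.uncurry k)) (b : ℝ) :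
    Measurable fun s => ∫⁻ u in Ioo b s, k s u := by
  have : (fun s => ∫⁻ u in Ioo b s, k s u) =
      fun s => ∫⁻ u, {p : ℝ × ℝ | b < p.2 ∧ p.2 < p.1}.indicator (Function.uncurry k) (s, u) := by
    ext s
    rw [← lintegral_indicator measurableSet_Ioo]
    rfl
  rw [this]
  have hS : MeasurableSet {p : ℝ × ℝ | b < p.2 ∧ p.2 < p.1} :=
    (measurableSet_lt measurable_const measurable_snd).inter
      (measurableSet_lt measurable_snd measurable_fst)
  exact Measurable.lintegral_prod_right
    (f := fun s u => {p : ℝ × ℝ | b < p.2 ∧ p.2 < p.1}.indicator (Function.uncurry k) (s, u))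
    (hk.indicator hS)

theorem measurable_weylLeft {f : ℝ → ℝ} (hf : Measurable f) (β : ℝ) :
    Measurable (weylLeft β f) := by
  have := measurable_setIntegral_Ioo_left
    (k := fun s u => (f s - f u) / (s - u) ^ (β + 1)) (by unfold Function.uncurry; fun_prop) 0
  unfold weylLeft
  fun_prop

theorem measurable_weylRight {g : ℝ → ℝ} (hg : Measurable g) (γ t : ℝ) :
    Measurable (weylRight γ t g) := by
  have := measurable_setIntegral_Ioo_right
    (k := fun s u => (g s - g u) / (u - s) ^ (γ + 1)) (by unfold Function.uncurry; fun_prop) t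
  unfold weylRight
  fun_prop

/-- Functions that vanish before `a`, are bounded by `M`, and are Hölder continuous of order `lam`
with constant `K` from `a` on. -/
structure CutHolder (a lam M K : ℝ) (f : ℝ → ℝ) : Prop where
  meas : Measurable f
  zero : ∀ s, s < a → f s = 0
  bdd : ∀ s, |f s| ≤ M
  const_nonneg : 0 ≤ K
  holder : ∀ s u, a ≤ u → u ≤ s → |f s - f u| ≤ K * (s - u) ^ lam

namespace CutHolder

variable {a lam M K β t : ℝ} {f : ℝ → ℝ}

theorem bound_nonneg (h : CutHolder a lam M K f) : 0 ≤ M := (abs_nonneg _).trans (h.bdd 0)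

/-- If the jump at a lies between u and s, then s - u ≥ s - a, so (s - a)^(-lam) (s - u)^lam ≥ 1 and
the jump, of size at most M, fits under a Hölder bound. The price is the factor |s - a|^(-lam),
which is integrable in s when lam < 1. -/
theorem abs_sub_le (h : CutHolder a lam M K f) (hlam : 0 < lam) {s u : ℝ} (hs : s ≠ a)
    (hu : u < s) : |f s - f u| ≤ (K + M * |s - a| ^ (-lam)) * (s - u) ^ lam := by
  have hM := h.bound_nonneg
  have hK := h.const_nonneg
  have h0 : 0 < s - u := sub_pos.2 hu
  rcases hs.lt_or_gt with hs | hs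
  · rw [h.zero s hs, h.zero u (hu.trans hs), sub_zero, abs_zero]
    positivity
  have h1 : 0 < s - a := sub_pos.2 hs
  rcases le_or_gt a u with hau | hau
  · calc |f s - f u| ≤ K * (s - u) ^ lam := h.holder s u hau hu.le
      _ ≤ _ := by
        gcongr
        exact le_add_of_nonneg_right (by positivity)
  · rw [h.zero u hau, sub_zero, abs_of_pos h1]
    have : 1 ≤ (s - a) ^ (-lam) * (s - u) ^ lam := by
      rw [Real.rpow_neg h1.le, ← div_eq_inv_mul, one_le_div (by positivity)]
      exact Real.rpow_le_rpow h1.le (by linarith) hlam.le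
    calc |f s| ≤ M * 1 := by simpa using h.bdd s
      _ ≤ M * ((s - a) ^ (-lam) * (s - u) ^ lam) := by gcongr
      _ ≤ _ := by
        rw [add_mul, mul_assoc]
        exact le_add_of_nonneg_left (by positivity)

theorem abs_quotient_le (h : CutHolder a lam M K f) (hlam : 0 < lam) {s u : ℝ} (hs : s ≠ a)
    (hu : u < s) :
    |(f s - f u) / (s - u) ^ (β + 1)| ≤
      (K + M * |s - a| ^ (-lam)) * (s - u) ^ (lam - β - 1) := by
  have h0 : 0 < s - u := sub_pos.2 hu
  rw [abs_div, abs_of_pos (by positivity : 0 < (s - u) ^ (β + 1)), div_le_iff₀ (by positivity),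
    mul_assoc, ← Real.rpow_add h0, show lam - β - 1 + (β + 1) = lam by ring]
  exact h.abs_sub_le hlam hs hu

theorem integrableOn_quotient (h : CutHolder a lam M K f) (hlam : 0 < lam) (hβ : β < lam)
    {s : ℝ} (hs : s ≠ a) :
    IntegrableOn (fun u => (f s - f u) / (s - u) ^ (β + 1)) (Ioo 0 s) := by
  have := h.meas
  refine Integrable.mono' ((integrableOn_sub_rpow' (ρ := lam - β - 1) (by linarith) 0 s).const_mul
    (K + M * |s - a| ^ (-lam))) (Measurable.aestronglyMeasurable (by fun_prop)) ?_
  filter_upwards [ae_restrict_mem measurableSet_Ioo] with u hu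
  exact h.abs_quotient_le hlam hs hu.2

/-- A majorant of the fractional derivative of a cut Hölder function on `(0, t)`. -/
def majorant (a lam M K β t s : ℝ) : ℝ :=
  (K + M * |s - a| ^ (-lam)) * (t ^ (lam - β) / (lam - β))

theorem majorant_integrableOn (a M K : ℝ) (hlam : lam < 1) (ha : 0 ≤ a)
    (hat : a ≤ t) : IntegrableOn (majorant a lam M K β t) (Ioo 0 t) := by
  unfold majorant
  refine Integrable.mul_const (Integrable.add (integrable_const _) (Integrable.const_mul ?_ _)) _
  exact integrableOn_abs_sub_rpow (by linarith) ha hat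

theorem setIntegral_abs_quotient_le (h : CutHolder a lam M K f) (hlam : 0 < lam) (hβ : β < lam)
    {s : ℝ} (hs : s ≠ a) (hs0 : 0 < s) (hst : s ≤ t) :
    ∫ u in Ioo 0 s, |(f s - f u) / (s - u) ^ (β + 1)| ≤ majorant a lam M K β t s := by
  have hM := h.bound_nonneg
  have hK := h.const_nonneg
  have i := (integrableOn_sub_rpow' (ρ := lam - β - 1) (by linarith) 0 s).const_mul
    (K + M * |s - a| ^ (-lam))
  calc _ ≤ ∫ u in Ioo 0 s, (K + M * |s - a| ^ (-lam)) * (s - u) ^ (lam - β - 1) := by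
        refine setIntegral_mono_on (h.integrableOn_quotient hlam hβ hs).abs i measurableSet_Ioo ?_
        intro u hu
        exact h.abs_quotient_le hlam hs hu.2
    _ = (K + M * |s - a| ^ (-lam)) * (s ^ (lam - β) / (lam - β)) := by
        rw [integral_const_mul, setIntegral_sub_rpow' (by linarith) hs0.le]
        simp
    _ ≤ _ := by
        unfold majorant
        have : 0 < lam - β := sub_pos.2 hβ
        gcongr

theorem abs_weylLeft_le (h : CutHolder a lam M K f) (hlam : 0 < lam) (hβ0 : 0 < β) (hβ1 : β < 1)
    (hβ : β < lam) {s : ℝ} (hs : s ≠ a) (hs0 : 0 < s) (hst : s ≤ t) :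
    |weylLeft β f s| ≤
      1 / Real.Gamma (1 - β) * (M * s ^ (-β) + β * majorant a lam M K β t s) := by
  have hΓ : 0 < Real.Gamma (1 - β) := Real.Gamma_pos_of_pos (by linarith)
  unfold weylLeft
  rw [abs_mul, abs_of_pos (by positivity : 0 < 1 / Real.Gamma (1 - β))]
  gcongr
  refine (abs_add_le _ _).trans (add_le_add ?_ ?_)
  · rw [abs_div, abs_of_pos (by positivity : 0 < s ^ β), Real.rpow_neg hs0.le, div_eq_mul_inv]
    gcongr
    exact h.bdd s
  · rw [abs_mul, abs_of_pos hβ0]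
    gcongr
    exact (abs_integral_le_integral_abs).trans (h.setIntegral_abs_quotient_le hlam hβ hs hs0 hst)

theorem besovNormTwo_lt_top (h : CutHolder a lam M K f) (hlam : 0 < lam) (hlam1 : lam < 1)
    (hβ : β < lam) (ha : 0 ≤ a) (hat : a ≤ t) : besovNormTwo β t f < ⊤ := by
  refine ENNReal.add_lt_top.2 ⟨?_, ?_⟩
  · have i := (integrableOn_sub_rpow (ρ := -β) (by linarith) 0 t).const_mul M
    refine lt_of_le_of_lt (setLIntegral_mono' measurableSet_Ioo fun s hs => ?_)
      i.lintegral_lt_top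
    refine ENNReal.ofReal_le_ofReal ?_
    have hs0 : 0 < s := hs.1
    rw [sub_zero, Real.rpow_neg hs0.le, div_eq_mul_inv]
    gcongr
    exact h.bdd s
  · refine lt_of_le_of_lt ?_ (majorant_integrableOn (β := β) a M K hlam1 ha hat).lintegral_lt_top
    refine lintegral_mono_ae ?_
    -- At s = a the bound is not available, since 0 to a negative power evaluates to 0; the point is
    -- discarded as a null set.
    have hne : ∀ᵐ s : ℝ, s ≠ a := by simp [ae_iff, measure_singleton]
    filter_upwards [ae_restrict_mem measurableSet_Ioo, ae_restrict_of_ae hne] with s hs hsa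
    have e := ofReal_integral_eq_lintegral_ofReal (h.integrableOn_quotient hlam hβ hsa).abs
      (ae_of_all _ fun _ => abs_nonneg _)
    refine le_trans (le_of_eq ?_) (ENNReal.ofReal_le_ofReal
      (h.setIntegral_abs_quotient_le hlam hβ hsa hs.1 hs.2.le))
    rw [e]
    refine setLIntegral_congr_fun measurableSet_Ioo fun u hu => ?_
    have : 0 < s - u := sub_pos.2 hu.2
    rw [abs_div, abs_of_pos (by positivity : 0 < (s - u) ^ (β + 1)), add_comm 1 β]

theorem tendsto_weylLeft {F : ℕ → ℝ → ℝ} (hF : ∀ n, CutHolder a lam M K (F n)) (hlam : 0 < lam)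
    (hβ : β < lam) (hf : ∀ s, Tendsto (fun n => F n s) atTop (𝓝 (f s))) {s : ℝ}
    (hs : s ≠ a) :
    Tendsto (fun n => weylLeft β (F n) s) atTop (𝓝 (weylLeft β f s)) := by
  unfold weylLeft
  refine Tendsto.const_mul _ (((hf s).div_const _).add (Tendsto.const_mul _ ?_))
  refine tendsto_integral_of_dominated_convergence
    (fun u => (K + M * |s - a| ^ (-lam)) * (s - u) ^ (lam - β - 1)) (fun n => ?_)
    ((integrableOn_sub_rpow' (ρ := lam - β - 1) (by linarith) 0 s).const_mul _) (fun n => ?_) ?_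
  · have := (hF n).meas
    exact Measurable.aestronglyMeasurable (by fun_prop)
  · filter_upwards [ae_restrict_mem measurableSet_Ioo] with u hu
    exact (hF n).abs_quotient_le hlam hs hu.2
  · exact ae_of_all _ fun u => ((hf s).sub (hf u)).div_const _

end CutHolder

/-! ### Right-sided derivatives of Hölder functions -/

section Right

variable {C lam γ t : ℝ} {g : ℝ → ℝ}

theorem abs_quotient_right_le (hg : ∀ x y, |g x - g y| ≤ C * |x - y| ^ lam) {s u : ℝ}
    (hu : s < u) : |(g s - g u) / (u - s) ^ (γ + 1)| ≤ C * (u - s) ^ (lam - γ - 1) := by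
  have h0 : 0 < u - s := sub_pos.2 hu
  rw [abs_div, abs_of_pos (by positivity : 0 < (u - s) ^ (γ + 1)), div_le_iff₀ (by positivity),
    mul_assoc, ← Real.rpow_add h0, show lam - γ - 1 + (γ + 1) = lam by ring]
  have := hg s u
  rwa [abs_sub_comm s u, abs_of_pos h0] at this

/-- Since γ < lam, both terms are controlled by (t - s)^(lam - γ), so this factor of the integrand
stays bounded and the singularities come only from the left derivative. -/
theorem abs_weylRight_le (hg : ∀ x y, |g x - g y| ≤ C * |x - y| ^ lam) (hC : 0 ≤ C)
    (hγ0 : 0 < γ) (hγ1 : γ < 1) (hγ : γ < lam) {s : ℝ} (hs : 0 < s) (hst : s < t) :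
    |weylRight γ t (fun r => g r - g t) s| ≤
      1 / Real.Gamma (1 - γ) * (C * t ^ (lam - γ) + γ * (C * (t ^ (lam - γ) / (lam - γ)))) := by
  have hΓ : 0 < Real.Gamma (1 - γ) := Real.Gamma_pos_of_pos (by linarith)
  have hts : 0 < t - s := sub_pos.2 hst
  have hlg : 0 < lam - γ := sub_pos.2 hγ
  have hle : (t - s) ^ (lam - γ) ≤ t ^ (lam - γ) :=
    Real.rpow_le_rpow hts.le (by linarith) hlg.le
  unfold weylRight
  rw [abs_mul, abs_of_pos (by positivity : 0 < 1 / Real.Gamma (1 - γ))]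
  gcongr
  refine (abs_add_le _ _).trans (add_le_add ?_ ?_)
  · rw [abs_div, abs_of_pos (by positivity : 0 < (t - s) ^ γ), div_le_iff₀ (by positivity)]
    calc |g s - g t| ≤ C * |s - t| ^ lam := hg s t
      _ = C * (t - s) ^ (lam - γ) * (t - s) ^ γ := by
        rw [mul_assoc, ← Real.rpow_add hts, abs_sub_comm, abs_of_pos hts]; simp
      _ ≤ _ := by gcongr
  · rw [abs_mul, abs_of_pos hγ0]
    gcongr
    simp only [sub_sub_sub_cancel_right]
    have i := (integrableOn_sub_rpow (ρ := lam - γ - 1) (by linarith) s t).const_mul C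
    calc |∫ u in Ioo s t, (g s - g u) / (u - s) ^ (γ + 1)|
        ≤ ∫ u in Ioo s t, C * (u - s) ^ (lam - γ - 1) := by
          refine norm_integral_le_of_norm_le (G := ℝ) i ?_
          filter_upwards [ae_restrict_mem measurableSet_Ioo] with u hu
          exact abs_quotient_right_le hg hu.1
      _ = C * ((t - s) ^ (lam - γ) / (lam - γ)) := by
          rw [integral_const_mul, setIntegral_sub_rpow (by linarith) hst.le]
          simp
      _ ≤ _ := by gcongr

theorem tendsto_weylRight {G : ℕ → ℝ → ℝ} (hG : ∀ n x y, |G n x - G n y| ≤ C * |x - y| ^ lam)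
    (hGm : ∀ n, Measurable (G n)) (hγ : γ < lam)
    (hg : ∀ s, Tendsto (fun n => G n s) atTop (𝓝 (g s))) (s : ℝ) :
    Tendsto (fun n => weylRight γ t (fun r => G n r - G n t) s) atTop
      (𝓝 (weylRight γ t (fun r => g r - g t) s)) := by
  unfold weylRight
  simp only [sub_sub_sub_cancel_right]
  refine Tendsto.const_mul _ ((((hg s).sub (hg t)).div_const _).add (Tendsto.const_mul _ ?_))
  refine tendsto_integral_of_dominated_convergence
    (fun u => C * (u - s) ^ (lam - γ - 1)) (fun n => ?_)
    ((integrableOn_sub_rpow (ρ := lam - γ - 1) (by linarith) s t).const_mul _) (fun n => ?_) ?_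
  · have := hGm n
    exact Measurable.aestronglyMeasurable (by fun_prop)
  · filter_upwards [ae_restrict_mem measurableSet_Ioo] with u hu
    exact abs_quotient_right_le (hG n) hu.1
  · exact ae_of_all _ fun u => ((hg s).sub (hg u)).div_const _

end Right

/-! ### The integral for smooth integrators -/

/-- Fubini on the triangle r < s. Uniformly bounded inner integrals suffice for joint integrability
because the outer interval has finite length. -/
theorem setIntegral_triangle_swap {F : ℝ → ℝ → ℝ} (hF : Measurable (Function.uncurry F))
    {a t B : ℝ} (hi : ∀ s ∈ Ioo a t, IntegrableOn (fun r => F r s) (Ioo a s))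
    (hB : ∀ s ∈ Ioo a t, ∫ r in Ioo a s, |F r s| ≤ B) :
    ∫ s in Ioo a t, ∫ r in Ioo a s, F r s = ∫ r in Ioo a t, ∫ s in Ioo r t, F r s := by
  set S : Set (ℝ × ℝ) := {p | p.2 < p.1} with hS
  have hSm : MeasurableSet S := measurableSet_lt measurable_snd measurable_fst
  set G : ℝ → ℝ → ℝ := fun s r => S.indicator (fun p => F p.2 p.1) (s, r) with hG
  have hFm : Measurable fun p : ℝ × ℝ => F p.2 p.1 := hF.comp measurable_swap
  have hGm : Measurable (Function.uncurry G) := hFm.indicator hSm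
  have e1 : ∀ s, G s = (Iio s).indicator (fun r => F r s) := fun s => rfl
  have e2 : ∀ r, (fun s => G s r) = (Ioi r).indicator (fun s => F r s) := fun r => rfl
  have r1 : ∀ s ∈ Ioo a t, (volume.restrict (Ioo a t)).restrict (Iio s) =
      volume.restrict (Ioo a s) := by
    intro s hs
    rw [Measure.restrict_restrict measurableSet_Iio, inter_comm, Ioo_inter_Iio,
      min_eq_right hs.2.le]
  have r2 : ∀ r ∈ Ioo a t, (volume.restrict (Ioo a t)).restrict (Ioi r) =
      volume.restrict (Ioo r t) := by
    intro s hs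
    rw [Measure.restrict_restrict measurableSet_Ioi, inter_comm, Ioo_inter_Ioi,
      max_eq_right hs.1.le]
  have hint : Integrable (Function.uncurry G)
      ((volume.restrict (Ioo a t)).prod (volume.restrict (Ioo a t))) := by
    rw [integrable_prod_iff hGm.aestronglyMeasurable]
    refine ⟨?_, ?_⟩
    · filter_upwards [ae_restrict_mem measurableSet_Ioo] with s hs
      change Integrable (G s) _
      rw [e1, integrable_indicator_iff measurableSet_Iio, IntegrableOn, r1 s hs]
      exact hi s hs
    · refine Integrable.mono' (integrable_const B)
        (hGm.stronglyMeasurable.norm.integral_prod_right.aestronglyMeasurable) ?_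
      filter_upwards [ae_restrict_mem measurableSet_Ioo] with s hs
      rw [Real.norm_of_nonneg (integral_nonneg fun _ => norm_nonneg _)]
      change ∫ r in Ioo a t, ‖G s r‖ ≤ B
      simp_rw [e1, norm_indicator_eq_indicator_norm]
      rw [integral_indicator measurableSet_Iio, r1 s hs]
      exact hB s hs
  have key := integral_integral_swap hint
  calc _ = ∫ s in Ioo a t, ∫ r in Ioo a t, G s r := by
        refine setIntegral_congr_fun measurableSet_Ioo fun s hs => ?_
        simp_rw [e1]
        rw [integral_indicator measurableSet_Iio, r1 s hs]
    _ = ∫ r in Ioo a t, ∫ s in Ioo a t, G s r := key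
    _ = _ := by
        refine setIntegral_congr_fun measurableSet_Ioo fun r hr => ?_
        simp only [e2]
        rw [integral_indicator measurableSet_Ioi, r2 r hr]

/-- The right-sided fractional integral of order `β` of `g'` up to the factor `Γ(β)`. -/
def abelRight (β t : ℝ) (g' : ℝ → ℝ) (s : ℝ) : ℝ :=
  ∫ u in Ioo s t, g' u * (u - s) ^ (β - 1)

theorem measurable_abelRight {g' : ℝ → ℝ} (hg' : Measurable g') (β t : ℝ) :
    Measurable (abelRight β t g') :=
  measurable_setIntegral_Ioo_right (k := fun s u => g' u * (u - s) ^ (β - 1))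
    (by unfold Function.uncurry; fun_prop) t

section Smooth

variable {β a t L : ℝ} {g' : ℝ → ℝ}

theorem abs_abelRight_le (hβ : 0 < β) (hL : ∀ x ∈ Icc a t, |g' x| ≤ L) {s : ℝ}
    (hs : s ∈ Ioo a t) : |abelRight β t g' s| ≤ L * ((t - a) ^ β / β) := by
  have hL0 : 0 ≤ L := (abs_nonneg _).trans (hL s (Ioo_subset_Icc_self hs))
  have i := (integrableOn_sub_rpow (ρ := β - 1) (by linarith) s t).const_mul L
  have h1 : 0 < t - s := sub_pos.2 hs.2
  have h2 : t - s ≤ t - a := by linarith [hs.1]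
  calc |∫ u in Ioo s t, g' u * (u - s) ^ (β - 1)| ≤ ∫ u in Ioo s t, L * (u - s) ^ (β - 1) := by
        refine norm_integral_le_of_norm_le (G := ℝ) i ?_
        filter_upwards [ae_restrict_mem measurableSet_Ioo] with u hu
        have h0 : 0 < u - s := sub_pos.2 hu.1
        rw [norm_mul, Real.norm_of_nonneg (by positivity : 0 ≤ (u - s) ^ (β - 1)),
          Real.norm_eq_abs]
        gcongr
        exact hL u ⟨(hs.1.trans hu.1).le, hu.2.le⟩
    _ = L * ((t - s) ^ β / β) := by
        rw [integral_const_mul, setIntegral_sub_rpow (by linarith) hs.2.le]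
        simp
    _ ≤ _ := by gcongr

/-- The semigroup law for fractional integrals of orders 1 - β and β: after Fubini the inner
integral is the Beta constant, and only the integral of g' is left. -/
theorem setIntegral_rpow_mul_abelRight {g : ℝ → ℝ} (hβ : 0 < β) (hβ' : β < 1)
    (hg : ∀ x, HasDerivAt g (g' x) x) (hg' : Continuous g')
    (hL : ∀ x ∈ Icc a t, |g' x| ≤ L) {r : ℝ} (har : a ≤ r) (hrt : r < t) :
    ∫ s in Ioo r t, (s - r) ^ (-β) * abelRight β t g' s =
      Real.Gamma (1 - β) * Real.Gamma β * (g t - g r) := by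
  have hm := hg'.measurable
  have hi : ∀ u ∈ Ioo r t, IntegrableOn
      (fun s => (s - r) ^ (-β) * (g' u * (u - s) ^ (β - 1))) (Ioo r u) := by
    intro u _
    refine Integrable.congr ((integrableOn_beta_kernel hβ hβ' r u).const_mul (g' u))
      (ae_of_all _ fun s => ?_)
    simp only
    ring
  have hB : ∀ u ∈ Ioo r t, ∫ s in Ioo r u, |(s - r) ^ (-β) * (g' u * (u - s) ^ (β - 1))| ≤
      L * (Real.Gamma (1 - β) * Real.Gamma β) := by
    intro u hu
    have : ∫ s in Ioo r u, |(s - r) ^ (-β) * (g' u * (u - s) ^ (β - 1))| =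
        ∫ s in Ioo r u, |g' u| * ((s - r) ^ (-β) * (u - s) ^ (β - 1)) := by
      refine setIntegral_congr_fun measurableSet_Ioo fun s hs => ?_
      have h0 : 0 < s - r := sub_pos.2 hs.1
      have h1 : 0 < u - s := sub_pos.2 hs.2
      rw [abs_mul, abs_mul, abs_of_pos (by positivity : 0 < (s - r) ^ (-β)),
        abs_of_pos (by positivity : 0 < (u - s) ^ (β - 1))]
      ring
    rw [this, integral_const_mul, setIntegral_beta_kernel hβ hβ' hu.1]
    have h1 := Real.Gamma_pos_of_pos hβ
    have h2 := Real.Gamma_pos_of_pos (sub_pos.2 hβ')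
    gcongr
    exact hL u ⟨har.trans hu.1.le, hu.2.le⟩
  have key := setIntegral_triangle_swap (F := fun s u => (s - r) ^ (-β) * (g' u * (u - s) ^ (β - 1)))
    (by unfold Function.uncurry; fun_prop) hi hB
  simp_rw [integral_const_mul] at key
  unfold abelRight
  rw [← key, ← intervalIntegral.integral_eq_sub_of_hasDerivAt (fun x _ => hg x)
    (hg'.intervalIntegrable r t), ← setIntegral_Ioo_eq_intervalIntegral hrt.le,
    ← integral_const_mul]
  refine setIntegral_congr_fun measurableSet_Ioo fun u hu => ?_
  rw [← setIntegral_beta_kernel hβ hβ' hu.1, ← integral_mul_const]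
  congr 1
  ext s
  ring

/-- Differentiating to order 1 - β is integrating g' to order β. The minus sign cancels the one in
`glsIntegrand`. -/
theorem weylRight_of_hasDerivAt {g : ℝ → ℝ} (hβ : 0 < β)
    (hg : ∀ x, HasDerivAt g (g' x) x) (hg' : Continuous g')
    (hL : ∀ x ∈ Icc a t, |g' x| ≤ L) {s : ℝ} (hs : s ∈ Ioo a t) :
    weylRight (1 - β) t (fun r => g r - g t) s = -(1 / Real.Gamma β * abelRight β t g' s) := by
  have key := setIntegral_deriv_mul_rpow (γ := 1 - β) hs.2 (by linarith) hg hg'.measurable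
    (L := L) (fun x hx => hL x ⟨hs.1.le.trans hx.1, hx.2⟩)
  rw [neg_sub] at key
  unfold weylRight abelRight
  have h1 : 0 < t - s := sub_pos.2 hs.2
  rw [key, sub_sub_cancel]
  have e : ∀ u, (g s - g t - (g u - g t)) / (u - s) ^ (1 - β + 1) =
      -((g u - g s) / (u - s) ^ (1 - β + 1)) := fun u => by rw [← neg_div]; congr 1; ring
  simp_rw [e]
  rw [integral_neg, ← neg_sub 1 β, Real.rpow_neg h1.le]
  ring

/-- The stretch u < a, where the function vanishes, integrates explicitly: one part cancels the
boundary term h s / s^β, the other combines with the integration by parts on (a, s) to leave the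
jump term h a (s - a)^(-β). -/
theorem weylLeft_of_hasDerivAt {h h' : ℝ → ℝ} {lam M K : ℝ} (hβ : 0 < β) (hβ' : β < 1)
    (hlam : 0 < lam) (hβlam : β < lam) (ha : 0 ≤ a)
    (hcut : CutHolder a lam M K ((Ici a).indicator h))
    (hh : ∀ x, HasDerivAt h (h' x) x) (hh' : Continuous h')
    (hL : ∀ x ∈ Icc a t, |h' x| ≤ L) {s : ℝ} (hs : s ∈ Ioo a t) :
    weylLeft β ((Ici a).indicator h) s = 1 / Real.Gamma (1 - β) *
      (h a * (s - a) ^ (-β) + ∫ r in Ioo a s, h' r * (s - r) ^ (-β)) := by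
  have hi := hcut.integrableOn_quotient hlam hβlam (s := s) hs.1.ne'
  have hs0 : 0 < s := ha.trans_lt hs.1
  have h1 : 0 < s - a := sub_pos.2 hs.1
  set f := (Ici a).indicator h with hf
  have fs : f s = h s := indicator_of_mem hs.1.le _
  have split : ∫ u in Ioo 0 s, (f s - f u) / (s - u) ^ (β + 1) =
      h s * (((s - a) ^ (-β) - s ^ (-β)) / β) +
        ∫ u in Ioo a s, (h s - h u) / (s - u) ^ (β + 1) := by
    rw [← intervalIntegrable_iff_integrableOn_Ioo_of_le hs0.le] at hi
    have i1 : IntervalIntegrable (fun u => (f s - f u) / (s - u) ^ (β + 1)) volume 0 a :=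
      hi.mono_set (by rw [uIcc_of_le ha, uIcc_of_le hs0.le]; exact Icc_subset_Icc_right hs.1.le)
    have i2 : IntervalIntegrable (fun u => (f s - f u) / (s - u) ^ (β + 1)) volume a s :=
      hi.mono_set (by rw [uIcc_of_le hs.1.le, uIcc_of_le hs0.le]; exact Icc_subset_Icc_left ha)
    rw [setIntegral_Ioo_eq_intervalIntegral hs0.le,
      ← intervalIntegral.integral_add_adjacent_intervals i1 i2,
      ← setIntegral_Ioo_eq_intervalIntegral ha, ← setIntegral_Ioo_eq_intervalIntegral hs.1.le]
    congr 1
    · have : ∫ u in Ioo 0 a, (f s - f u) / (s - u) ^ (β + 1) =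
          ∫ u in Ioo 0 a, h s * (s - u) ^ (-β - 1) := by
        refine setIntegral_congr_fun measurableSet_Ioo fun u hu => ?_
        have h0 : 0 < s - u := by linarith [hu.2]
        have fu : f u = 0 := indicator_of_notMem (by simpa using hu.2) _
        rw [fs, fu, sub_zero, div_eq_mul_inv, ← Real.rpow_neg h0.le]
        congr 2
        ring
      rw [this, integral_const_mul, setIntegral_Ioo_eq_intervalIntegral ha,
        intervalIntegral.integral_comp_sub_left (fun u => u ^ (-β - 1)) s, integral_rpow, sub_zero]
      · rw [sub_add_cancel, div_neg, ← neg_div, neg_sub]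
      · right
        refine ⟨by linarith, ?_⟩
        rw [sub_zero, uIcc_of_le (by linarith)]
        exact fun h => by linarith [h.1]
    · refine setIntegral_congr_fun measurableSet_Ioo fun u hu => ?_
      have fu : f u = h u := indicator_of_mem (show a ≤ u from hu.1.le) _
      rw [fs, fu]
  have key := setIntegral_deriv_mul_rpow' (γ := β) hs.1 hβ' hh hh'.measurable
    (L := L) (fun x hx => hL x ⟨hx.1, hx.2.trans hs.2.le⟩)
  unfold weylLeft
  rw [split, key, fs, div_eq_mul_inv (h s), ← Real.rpow_neg hs0.le]
  field_simp
  ring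

/-- The fundamental theorem of calculus for the generalized Lebesgue–Stieltjes integral with a
continuously differentiable integrator. -/
theorem glsIntegral_of_hasDerivAt {Φ g : ℝ → ℝ} {lam M K : ℝ} (hβ : 0 < β) (hβ' : β < 1)
    (hlam : 0 < lam) (hβlam : β < lam) (ha : 0 ≤ a) (hat : a < t) (hΦ : ContDiff ℝ 2 Φ)
    (hcut : CutHolder a lam M K ((Ici a).indicator fun r => deriv Φ (g r)))
    (hg : ∀ x, HasDerivAt g (g' x) x) (hg' : Continuous g') :
    glsIntegral β ((Ici a).indicator fun r => deriv Φ (g r)) g t = Φ (g t) - Φ (g a) := by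
  have hgc : Continuous g := continuous_iff_continuousAt.2 fun x => (hg x).continuousAt
  have hΦ1 : ContDiff ℝ 1 (deriv Φ) := by
    have : ContDiff ℝ (1 + 1) Φ := by simpa [one_add_one_eq_two] using hΦ
    exact (contDiff_succ_iff_deriv.1 this).2.2
  have dΦ : ∀ x, HasDerivAt Φ (deriv Φ x) x := fun x =>
    (hΦ.differentiable (by norm_num) x).hasDerivAt
  have ddΦ : ∀ x, HasDerivAt (deriv Φ) (deriv (deriv Φ) x) x := fun x =>
    (hΦ1.differentiable (by norm_num) x).hasDerivAt
  have cddΦ : Continuous (deriv (deriv Φ)) := hΦ1.continuous_deriv le_rfl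
  set h : ℝ → ℝ := fun r => deriv Φ (g r) with hh
  obtain ⟨h', dh, ch'⟩ : ∃ h' : ℝ → ℝ, (∀ x, HasDerivAt h (h' x) x) ∧ Continuous h' :=
    ⟨fun r => deriv (deriv Φ) (g r) * g' r, fun x => (ddΦ (g x)).comp x (hg x),
      (cddΦ.comp hgc).mul hg'⟩
  obtain ⟨L, hL⟩ := isCompact_Icc.exists_bound_of_continuousOn (s := Icc a t) hg'.continuousOn
  obtain ⟨L', hL'⟩ := isCompact_Icc.exists_bound_of_continuousOn (s := Icc a t) ch'.continuousOn
  have hL0 : 0 ≤ L := (norm_nonneg _).trans (hL a (left_mem_Icc.2 hat.le))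
  have hL0' : 0 ≤ L' := (norm_nonneg _).trans (hL' a (left_mem_Icc.2 hat.le))
  have hΓ1 := Real.Gamma_pos_of_pos hβ
  have hΓ2 := Real.Gamma_pos_of_pos (sub_pos.2 hβ')
  set Q := abelRight β t g' with hQ
  have hQm : Measurable Q := measurable_abelRight hg'.measurable β t
  have hQb : ∀ s ∈ Ioo a t, |Q s| ≤ L * ((t - a) ^ β / β) := fun s hs => abs_abelRight_le hβ hL hs
  have hta : 0 < t - a := sub_pos.2 hat
  have hi : ∀ s ∈ Ioo a t, IntegrableOn (fun r => h' r * ((s - r) ^ (-β) * Q s)) (Ioo a s) := by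
    intro s hs
    refine Integrable.mono' (((integrableOn_sub_rpow' (ρ := -β) (by linarith) a s).const_mul
      L').mul_const |Q s|) ?_ ?_
    · have := ch'.measurable
      exact Measurable.aestronglyMeasurable (by fun_prop)
    · filter_upwards [ae_restrict_mem measurableSet_Ioo] with r hr
      have h0 : 0 < s - r := sub_pos.2 hr.2
      rw [norm_mul, norm_mul, Real.norm_of_nonneg (by positivity : 0 ≤ (s - r) ^ (-β)),
        Real.norm_eq_abs (Q s), ← mul_assoc]
      gcongr
      exact hL' r ⟨hr.1.le, (hr.2.trans hs.2).le⟩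
  have hB : ∀ s ∈ Ioo a t, ∫ r in Ioo a s, |h' r * ((s - r) ^ (-β) * Q s)| ≤
      L' * ((t - a) ^ (1 - β) / (1 - β)) * (L * ((t - a) ^ β / β)) := by
    intro s hs
    have h1 : 0 < 1 - β := sub_pos.2 hβ'
    have hsa : 0 < s - a := sub_pos.2 hs.1
    calc ∫ r in Ioo a s, |h' r * ((s - r) ^ (-β) * Q s)|
        ≤ ∫ r in Ioo a s, L' * (s - r) ^ (-β) * |Q s| := by
          refine setIntegral_mono_on (hi s hs).abs
            (((integrableOn_sub_rpow' (ρ := -β) (by linarith) a s).const_mul L').mul_const |Q s|)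
            measurableSet_Ioo fun r hr => ?_
          have h0 : 0 < s - r := sub_pos.2 hr.2
          rw [abs_mul, abs_mul, abs_of_pos (by positivity : 0 < (s - r) ^ (-β)), ← mul_assoc]
          gcongr
          exact hL' r ⟨hr.1.le, (hr.2.trans hs.2).le⟩
      _ = L' * ((s - a) ^ (1 - β) / (1 - β)) * |Q s| := by
          rw [integral_mul_const, integral_const_mul,
            setIntegral_sub_rpow' (by linarith) hs.1.le, neg_add_eq_sub]
      _ ≤ _ := by
          gcongr
          · exact hs.2.le
          · exact hQb s hs
  have swap := setIntegral_triangle_swap (F := fun r s => h' r * ((s - r) ^ (-β) * Q s))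
    (by have := ch'.measurable; unfold Function.uncurry; fun_prop) hi hB
  -- With the order swapped, the inner integral over s is given by the semigroup law.
  have e1 : ∫ r in Ioo a t, ∫ s in Ioo r t, h' r * ((s - r) ^ (-β) * Q s) =
      Real.Gamma (1 - β) * Real.Gamma β * ∫ r in Ioo a t, h' r * (g t - g r) := by
    rw [← integral_const_mul]
    refine setIntegral_congr_fun measurableSet_Ioo fun r hr => ?_
    rw [integral_const_mul, setIntegral_rpow_mul_abelRight hβ hβ' hg hg' hL hr.1.le hr.2]
    ring
  -- Ordinary integration by parts: r ↦ h r (g t - g r) + Φ (g r) is a primitive, because h = Φ' ∘ g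
  -- cancels the two terms containing g'.
  have e2 : h a * (g t - g a) + ∫ r in Ioo a t, h' r * (g t - g r) = Φ (g t) - Φ (g a) := by
    rw [setIntegral_Ioo_eq_intervalIntegral hat.le,
      intervalIntegral.integral_eq_sub_of_hasDerivAt (f := fun r => h r * (g t - g r) + Φ (g r))]
    · ring
    · intro x _
      refine (((dh x).mul ((hg x).const_sub (g t))).add ((dΦ (g x)).comp x (hg x))).congr_deriv ?_
      simp only [hh]
      ring
    · exact (ch'.mul (continuous_const.sub hgc)).intervalIntegrable _ _
  -- Before a the left derivative vanishes, so the integral starts at a, where both derivatives have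
  -- their Abel form.
  have e3 : glsIntegral β ((Ici a).indicator h) g t =
      ∫ s in Ioo a t, (1 / (Real.Gamma (1 - β) * Real.Gamma β)) *
        (h a * ((s - a) ^ (-β) * Q s) + ∫ r in Ioo a s, h' r * ((s - r) ^ (-β) * Q s)) := by
    have e : glsIntegral β ((Ici a).indicator h) g t =
        ∫ s in Ioo a t, glsIntegrand β ((Ici a).indicator h) g t s := by
      refine setIntegral_eq_of_subset_of_ae_sdiff_eq_zero nullMeasurableSet_Ioo
        (Ioo_subset_Ioo_left ha) ?_
      have hne : ∀ᵐ s : ℝ, s ≠ a := by simp [ae_iff, measure_singleton]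
      filter_upwards [hne] with s hsa hs
      have hlt : s < a := by
        rcases lt_or_gt_of_ne hsa with h | h
        · exact h
        · exact absurd ⟨h, hs.1.2⟩ hs.2
      have : weylLeft β ((Ici a).indicator h) s = 0 := by
        unfold weylLeft
        rw [hcut.zero s hlt, setIntegral_eq_zero_of_forall_eq_zero]
        · simp
        · intro u hu
          rw [hcut.zero u (hu.2.trans hlt)]
          simp
      simp [glsIntegrand, this]
    rw [e]
    refine setIntegral_congr_fun measurableSet_Ioo fun s hs => ?_
    simp only [glsIntegrand]
    rw [weylRight_of_hasDerivAt hβ hg hg' hL hs,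
      weylLeft_of_hasDerivAt hβ hβ' hlam hβlam ha hcut dh ch' hL' hs]
    simp_rw [← mul_assoc]
    rw [integral_mul_const, ← hQ]
    field_simp
  have i1 : IntegrableOn (fun s => h a * ((s - a) ^ (-β) * Q s)) (Ioo a t) := by
    refine Integrable.const_mul ?_ _
    refine Integrable.mono' ((integrableOn_sub_rpow (ρ := -β) (by linarith) a t).mul_const
      (L * ((t - a) ^ β / β))) (Measurable.aestronglyMeasurable (by fun_prop)) ?_
    filter_upwards [ae_restrict_mem measurableSet_Ioo] with s hs
    have h0 : 0 < s - a := sub_pos.2 hs.1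
    rw [norm_mul, Real.norm_of_nonneg (by positivity : 0 ≤ (s - a) ^ (-β))]
    gcongr
    exact hQb s hs
  have i2 : IntegrableOn (fun s => ∫ r in Ioo a s, h' r * ((s - r) ^ (-β) * Q s)) (Ioo a t) := by
    refine Integrable.mono' (integrable_const
      (L' * ((t - a) ^ (1 - β) / (1 - β)) * (L * ((t - a) ^ β / β)))) ?_ ?_
    · have := ch'.measurable
      exact (measurable_setIntegral_Ioo_left (k := fun s r => h' r * ((s - r) ^ (-β) * Q s))
        (by unfold Function.uncurry; fun_prop) a).aestronglyMeasurable
    · filter_upwards [ae_restrict_mem measurableSet_Ioo] with s hs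
      exact (norm_integral_le_integral_norm _).trans (hB s hs)
  rw [e3, integral_const_mul, integral_add i1 i2, integral_const_mul, swap, e1,
    setIntegral_rpow_mul_abelRight hβ hβ' hg hg' hL le_rfl hat, ← e2]
  field_simp

end Smooth

/-! ### Linearity of the generalized Lebesgue–Stieltjes integral -/

/-- The generalized Lebesgue–Stieltjes integral `∫_0^t f dg` converges absolutely to `v`, for a
measurable integrand of finite Besov norm. -/
structure HasGLSIntegral (β : ℝ) (f g : ℝ → ℝ) (t v : ℝ) : Prop where
  meas : Measurable f
  norm_lt_top : besovNormTwo β t f < ⊤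
  quotient : ∀ᵐ s ∂volume.restrict (Ioo 0 t),
    IntegrableOn (fun u => (f s - f u) / (s - u) ^ (β + 1)) (Ioo 0 s)
  integrable : IntegrableOn (glsIntegrand β f g t) (Ioo 0 t)
  eq : glsIntegral β f g t = v

theorem weylLeft_congr {β t : ℝ} {f f' : ℝ → ℝ} (h : ∀ s ∈ Ioo 0 t, f s = f' s) {s : ℝ}
    (hs : s ∈ Ioo 0 t) : weylLeft β f s = weylLeft β f' s := by
  unfold weylLeft
  rw [h s hs]
  congr 3
  refine setIntegral_congr_fun measurableSet_Ioo fun u hu => ?_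
  rw [h u ⟨hu.1, hu.2.trans hs.2⟩]

theorem weylLeft_eq_zero {β a : ℝ} {f : ℝ → ℝ} (h : ∀ s ∈ Ico 0 a, f s = 0) {s : ℝ}
    (hs : s ∈ Ioo 0 a) : weylLeft β f s = 0 := by
  rw [weylLeft_congr (f' := 0) (fun s hs => h s (Ioo_subset_Ico_self hs)) hs]
  simp [weylLeft]

theorem weylRight_congr {γ t s : ℝ} {g g' : ℝ → ℝ} (h : ∀ r ∈ Icc s t, g r = g' r)
    (hs : s ≤ t) : weylRight γ t g s = weylRight γ t g' s := by
  unfold weylRight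
  rw [h s (left_mem_Icc.2 hs)]
  congr 3
  refine setIntegral_congr_fun measurableSet_Ioo fun u hu => ?_
  rw [h u (Ioo_subset_Icc_self hu)]

/-- The integrator matters only from a on: before a the left derivative is 0, and from a on the
right derivative looks only forward. This later allows a path to be replaced by a globally Hölder
function. -/
theorem glsIntegrand_congr {β a t : ℝ} {f f' g g' : ℝ → ℝ} (hf : ∀ s ∈ Ioo 0 t, f s = f' s)
    (hfa : ∀ s ∈ Ico 0 a, f s = 0) (hg : ∀ s ∈ Icc a t, g s = g' s) {s : ℝ} (hs : s ∈ Ioo 0 t) :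
    glsIntegrand β f g t s = glsIntegrand β f' g' t s := by
  unfold glsIntegrand
  rw [← weylLeft_congr hf hs]
  rcases lt_or_ge s a with h | h
  · rw [weylLeft_eq_zero hfa ⟨hs.1, h⟩, zero_mul, zero_mul]
  · rw [weylRight_congr (g' := fun r => g' r - g' t) (fun r hr => ?_) hs.2.le]
    rw [hg r ⟨h.trans hr.1, hr.2⟩, hg t ⟨h.trans hs.2.le, le_rfl⟩]

theorem glsIntegral_congr {β a t : ℝ} {f f' g g' : ℝ → ℝ} (hf : ∀ s ∈ Ioo 0 t, f s = f' s)
    (hfa : ∀ s ∈ Ico 0 a, f s = 0) (hg : ∀ s ∈ Icc a t, g s = g' s) :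
    glsIntegral β f g t = glsIntegral β f' g' t :=
  setIntegral_congr_fun measurableSet_Ioo fun _ hs => glsIntegrand_congr hf hfa hg hs

theorem besovNormTwo_congr {β t : ℝ} {f f' : ℝ → ℝ} (hf : ∀ s ∈ Ioo 0 t, f s = f' s) :
    besovNormTwo β t f = besovNormTwo β t f' := by
  unfold besovNormTwo
  congr 1
  · refine setLIntegral_congr_fun measurableSet_Ioo fun s hs => ?_
    rw [hf s hs]
  · refine setLIntegral_congr_fun measurableSet_Ioo fun s hs => ?_
    refine setLIntegral_congr_fun measurableSet_Ioo fun u hu => ?_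
    rw [hf s hs, hf u ⟨hu.1, hu.2.trans hs.2⟩]

theorem besovNormTwo_add_le {β t : ℝ} {f f' : ℝ → ℝ} (hf : Measurable f) :
    besovNormTwo β t (f + f') ≤ besovNormTwo β t f + besovNormTwo β t f' := by
  have key : ∀ x y c : ℝ, 0 ≤ c → ENNReal.ofReal (|x + y| / c) ≤
      ENNReal.ofReal (|x| / c) + ENNReal.ofReal (|y| / c) := by
    intro x y c hc
    rw [← ENNReal.ofReal_add (by positivity) (by positivity), ← add_div]
    gcongr
    exact abs_add_le x y
  unfold besovNormTwo
  rw [add_add_add_comm]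
  gcongr
  · rw [← lintegral_add_left (by fun_prop)]
    refine setLIntegral_mono' measurableSet_Ioo fun s hs => ?_
    exact key _ _ _ (Real.rpow_nonneg hs.1.le _)
  · rw [← lintegral_add_left (measurable_setLIntegral_Ioo_left
      (k := fun s u => ENNReal.ofReal (|f s - f u| / (s - u) ^ (1 + β)))
      (by unfold Function.uncurry; fun_prop) 0)]
    refine setLIntegral_mono' measurableSet_Ioo fun s hs => ?_
    rw [← lintegral_add_left (by fun_prop)]
    refine setLIntegral_mono' measurableSet_Ioo fun u hu => ?_
    have := key (f s - f u) (f' s - f' u) ((s - u) ^ (1 + β))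
      (Real.rpow_nonneg (sub_pos.2 hu.2).le _)
    rwa [sub_add_sub_comm] at this

theorem besovNormTwo_const_mul (β t c : ℝ) (f : ℝ → ℝ) :
    besovNormTwo β t (fun s => c * f s) = ENNReal.ofReal |c| * besovNormTwo β t f := by
  unfold besovNormTwo
  rw [mul_add, ← lintegral_const_mul' _ _ ENNReal.ofReal_ne_top,
    ← lintegral_const_mul' _ _ ENNReal.ofReal_ne_top]
  simp_rw [← lintegral_const_mul' _ _ (ENNReal.ofReal_ne_top (r := |c|)),
    ← ENNReal.ofReal_mul (abs_nonneg c), ← mul_div_assoc, ← abs_mul, mul_sub]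

namespace HasGLSIntegral

variable {β t v w : ℝ} {f f' g g' : ℝ → ℝ}

theorem congr_integrand (h : HasGLSIntegral β f g t v) (hf' : Measurable f')
    (hff' : ∀ s ∈ Ioo 0 t, f s = f' s) : HasGLSIntegral β f' g t v where
  meas := hf'
  norm_lt_top := besovNormTwo_congr hff' ▸ h.norm_lt_top
  quotient := by
    filter_upwards [h.quotient, ae_restrict_mem measurableSet_Ioo] with s hs hst
    refine hs.congr_fun (fun u hu => ?_) measurableSet_Ioo
    simp only
    rw [hff' s hst, hff' u ⟨hu.1, hu.2.trans hst.2⟩]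
  integrable := h.integrable.congr_fun (fun s hs =>
    glsIntegrand_congr (a := 0) hff' (by simp) (fun _ _ => rfl) hs) measurableSet_Ioo
  eq := (glsIntegral_congr (a := 0) hff' (by simp) (fun _ _ => rfl)).symm.trans h.eq

theorem zero (β : ℝ) (g : ℝ → ℝ) (t : ℝ) : HasGLSIntegral β (fun _ => 0) g t 0 where
  meas := measurable_const
  norm_lt_top := by simp [besovNormTwo]
  quotient := by simp
  integrable := by
    have : glsIntegrand β (fun _ => 0) g t = fun _ => 0 := by
      ext; simp [glsIntegrand, weylLeft]
    rw [this]
    exact integrableOn_zero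
  eq := by simp [glsIntegral, glsIntegrand, weylLeft]

/-- The inner integral splits only where both difference quotients are integrable, which is the
purpose of the field `quotient`. -/
theorem glsIntegrand_add (h : HasGLSIntegral β f g t v) (h' : HasGLSIntegral β f' g t w) :
    ∀ᵐ s ∂volume.restrict (Ioo 0 t), glsIntegrand β (f + f') g t s =
      glsIntegrand β f g t s + glsIntegrand β f' g t s := by
  filter_upwards [h.quotient, h'.quotient] with s h1 h2
  have : weylLeft β (f + f') s = weylLeft β f s + weylLeft β f' s := by
    unfold weylLeft
    have e : ∀ u, ((f + f') s - (f + f') u) / (s - u) ^ (β + 1) =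
        (f s - f u) / (s - u) ^ (β + 1) + (f' s - f' u) / (s - u) ^ (β + 1) := by
      intro u
      simp only [Pi.add_apply]
      ring
    simp_rw [e]
    rw [integral_add h1 h2, Pi.add_apply]
    ring
  unfold glsIntegrand
  rw [this]
  ring

theorem add (h : HasGLSIntegral β f g t v) (h' : HasGLSIntegral β f' g t w) :
    HasGLSIntegral β (f + f') g t (v + w) where
  meas := h.meas.add h'.meas
  norm_lt_top := (besovNormTwo_add_le h.meas).trans_lt
    (ENNReal.add_lt_top.2 ⟨h.norm_lt_top, h'.norm_lt_top⟩)
  quotient := by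
    filter_upwards [h.quotient, h'.quotient] with s h1 h2
    refine (h1.add h2).congr (ae_of_all _ fun u => ?_)
    simp only [Pi.add_apply]
    ring
  integrable := (h.integrable.add h'.integrable).congr (by
    filter_upwards [h.glsIntegrand_add h'] with s hs
    exact hs.symm)
  eq := by
    rw [← h.eq, ← h'.eq]
    unfold glsIntegral
    rw [← integral_add h.integrable h'.integrable]
    exact integral_congr_ae (h.glsIntegrand_add h')

theorem const_mul (h : HasGLSIntegral β f g t v) (c : ℝ) :
    HasGLSIntegral β (fun s => c * f s) g t (c * v) := by
  have e : glsIntegrand β (fun s => c * f s) g t = fun s => c * glsIntegrand β f g t s := by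
    ext s
    unfold glsIntegrand weylLeft
    simp_rw [← mul_sub, mul_div_assoc, integral_const_mul]
    ring
  refine ⟨h.meas.const_mul c, ?_, ?_, ?_, ?_⟩
  · rw [besovNormTwo_const_mul]
    exact ENNReal.mul_lt_top ENNReal.ofReal_lt_top h.norm_lt_top
  · filter_upwards [h.quotient] with s hs
    refine (hs.const_mul c).congr (ae_of_all _ fun u => ?_)
    simp only
    ring
  · rw [e]
    exact h.integrable.const_mul c
  · rw [glsIntegral, e, integral_const_mul, ← h.eq, glsIntegral]

theorem sum {ι : Type*} (s : Finset ι) {f : ι → ℝ → ℝ} {v : ι → ℝ}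
    (h : ∀ i ∈ s, HasGLSIntegral β (f i) g t (v i)) :
    HasGLSIntegral β (fun r => ∑ i ∈ s, f i r) g t (∑ i ∈ s, v i) := by
  classical
  induction s using Finset.induction_on with
  | empty => simpa using zero β g t
  | insert i s hi ih =>
    have := (h i (Finset.mem_insert_self i s)).add
      (ih fun j hj => h j (Finset.mem_insert_of_mem hj))
    simp_rw [Finset.sum_insert hi]
    exact this

end HasGLSIntegral

/-! ### The integral for Hölder continuous integrators -/

/-- The order of quantifiers is the point: M and K come before g, so one pair serves a path and all
its smooth approximations. They come from bounds of φ and φ' on [-R, R]. -/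
theorem cutHolder_comp {φ : ℝ → ℝ} (hφ : ContDiff ℝ 1 φ) (R C lam a : ℝ) (hC : 0 ≤ C) :
    ∃ M K, ∀ g : ℝ → ℝ, Measurable g → (∀ x, |g x| ≤ R) →
      (∀ x y, |g x - g y| ≤ C * |x - y| ^ lam) →
      CutHolder a lam M K ((Ici a).indicator fun r => φ (g r)) := by
  obtain ⟨M, hM⟩ := isCompact_Icc.exists_bound_of_continuousOn (s := Icc (-R) R)
    hφ.continuous.continuousOn
  obtain ⟨L, hL⟩ := isCompact_Icc.exists_bound_of_continuousOn (s := Icc (-R) R)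
    (hφ.continuous_deriv le_rfl).continuousOn
  refine ⟨M, L * C, fun g hgm hR hg => ?_⟩
  have hmem : ∀ x, g x ∈ Icc (-R) R := fun x => abs_le.1 (hR x)
  have hL0 : 0 ≤ L := (norm_nonneg _).trans (hL _ (hmem 0))
  have hM0 : 0 ≤ M := (norm_nonneg _).trans (hM _ (hmem 0))
  refine ⟨(hφ.continuous.measurable.comp hgm).indicator measurableSet_Ici, fun s hs => ?_,
    fun s => ?_, by positivity, fun s u hau hus => ?_⟩
  · exact indicator_of_notMem (by simpa using hs) _
  · by_cases hs : s ∈ Ici a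
    · rw [indicator_of_mem hs]
      exact hM _ (hmem s)
    · rw [indicator_of_notMem hs]
      simpa using hM0
  · rw [indicator_of_mem (show s ∈ Ici a from hau.trans hus),
      indicator_of_mem (show u ∈ Ici a from hau)]
    have := (convex_Icc (-R) R).norm_image_sub_le_of_norm_deriv_le
      (fun x _ => hφ.differentiable (by norm_num) x) hL (hmem u) (hmem s)
    calc |φ (g s) - φ (g u)| ≤ L * |g s - g u| := this
      _ ≤ L * (C * |s - u| ^ lam) := by gcongr; exact hg s u
      _ = _ := by rw [abs_of_nonneg (sub_nonneg.2 hus), mul_assoc]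

/-- The Steklov average of `g` over `[s, s + ε]`. -/
def steklov (ε : ℝ) (g : ℝ → ℝ) (s : ℝ) : ℝ := ∫ x in (0 : ℝ)..1, g (s + ε * x)

theorem hasDerivAt_steklov {ε : ℝ} (hε : ε ≠ 0) {g : ℝ → ℝ} (hg : Continuous g) (s : ℝ) :
    HasDerivAt (steklov ε g) (ε⁻¹ * (g (s + ε) - g s)) s := by
  have e : steklov ε g = fun s => ε⁻¹ * ((∫ x in (0 : ℝ)..(s + ε), g x) - ∫ x in (0 : ℝ)..s, g x) := by
    ext s
    unfold steklov
    rw [intervalIntegral.integral_comp_add_mul _ hε, smul_eq_mul,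
      intervalIntegral.integral_interval_sub_left (hg.intervalIntegrable _ _)
      (hg.intervalIntegrable _ _)]
    simp
  rw [e]
  have d : ∀ y, HasDerivAt (fun y => ∫ x in (0 : ℝ)..y, g x) (g y) y := fun y =>
    intervalIntegral.integral_hasDerivAt_right (hg.intervalIntegrable _ _)
      (hg.stronglyMeasurableAtFilter _ _) hg.continuousAt
  exact (((d (s + ε)).comp_add_const s ε).sub (d s)).const_mul _

/-- The factor c serves two uses: c = 1 transfers the Hölder bound to the averages, c = 0 the
uniform bound. -/
theorem abs_steklov_sub_le {ε C : ℝ} {g : ℝ → ℝ} (hg : Continuous g) {s u c : ℝ}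
    (h : ∀ x ∈ Icc (0 : ℝ) 1, |g (s + ε * x) - c * g (u + ε * x)| ≤ C) :
    |steklov ε g s - c * steklov ε g u| ≤ C := by
  unfold steklov
  rw [← intervalIntegral.integral_const_mul, ← intervalIntegral.integral_sub
    (by exact Continuous.intervalIntegrable (by fun_prop) _ _)
    (by exact Continuous.intervalIntegrable (by fun_prop) _ _)]
  have := intervalIntegral.norm_integral_le_of_norm_le_const (a := 0) (b := 1)
    (f := fun x => g (s + ε * x) - c * g (u + ε * x)) (C := C) (fun x hx => by
      rw [uIoc_of_le zero_le_one] at hx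
      exact h x (Ioc_subset_Icc_self hx))
  simpa using this

section Holder

variable {C lam R β t : ℝ} {g : ℝ → ℝ}

theorem continuous_of_holder (hlam : 0 < lam) (hg : ∀ x y, |g x - g y| ≤ C * |x - y| ^ lam) :
    Continuous g := by
  refine continuous_iff_continuousAt.2 fun x => ?_
  rw [ContinuousAt, tendsto_iff_norm_sub_tendsto_zero]
  have : Tendsto (fun y => C * |y - x| ^ lam) (𝓝 x) (𝓝 (C * |x - x| ^ lam)) :=
    ContinuousAt.tendsto (f := fun y => C * |y - x| ^ lam)
      (continuousAt_const.mul (ContinuousAt.rpow_const (by fun_prop) (Or.inr hlam.le)))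
  rw [sub_self, abs_zero, Real.zero_rpow hlam.ne', mul_zero] at this
  exact squeeze_zero (fun _ => norm_nonneg _) (fun y => hg y x) this

/-- The fundamental theorem of calculus for the generalized Lebesgue–Stieltjes integral with a
Hölder continuous integrator. -/
theorem hasGLSIntegral_comp {Φ : ℝ → ℝ} (hΦ : ContDiff ℝ 2 Φ) {a : ℝ} (hβ : 0 < β) (hβ' : β < 1)
    (hlam1 : lam < 1) (hβlam : β < lam) (hβlam' : 1 - β < lam) (ha : 0 ≤ a) (hC : 0 ≤ C)
    (hg : ∀ x y, |g x - g y| ≤ C * |x - y| ^ lam) (hR : ∀ x, |g x| ≤ R) :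
    HasGLSIntegral β ((Ici a).indicator fun r => deriv Φ (g r)) g t
      (Φ (g t) - Φ (g (min a t))) := by
  have hlam : 0 < lam := hβ.trans hβlam
  have hgc : Continuous g := continuous_of_holder hlam hg
  have hφ : ContDiff ℝ 1 (deriv Φ) := by
    have : ContDiff ℝ (1 + 1) Φ := by simpa [one_add_one_eq_two] using hΦ
    exact (contDiff_succ_iff_deriv.1 this).2.2
  have hfm : Measurable ((Ici a).indicator fun r => deriv Φ (g r)) :=
    (hφ.continuous.comp hgc).measurable.indicator measurableSet_Ici
  rcases le_or_gt t a with hta | hat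
  · rw [min_eq_right hta, sub_self]
    refine (HasGLSIntegral.zero β g t).congr_integrand hfm fun s hs => ?_
    exact (indicator_of_notMem (by simpa using hs.2.trans_le hta) _).symm
  rw [min_eq_left hat.le]
  obtain ⟨M, K, hMK⟩ := cutHolder_comp hφ R C lam a hC
  have hcut := hMK g hgc.measurable hR hg
  have hM := hcut.bound_nonneg
  have ht : 0 < t := ha.trans_lt hat
  have hne : ∀ᵐ s : ℝ, s ≠ a := by simp [ae_iff, measure_singleton]
  set E : ℝ := 1 / Real.Gamma (1 - (1 - β)) * (C * t ^ (lam - (1 - β)) +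
    (1 - β) * (C * (t ^ (lam - (1 - β)) / (lam - (1 - β))))) with hE
  set D : ℝ → ℝ := fun s => 1 / Real.Gamma (1 - β) *
    (M * s ^ (-β) + β * CutHolder.majorant a lam M K β t s) with hD
  have hDi : IntegrableOn (fun s => D s * E) (Ioo 0 t) := by
    refine Integrable.mul_const (Integrable.const_mul (Integrable.add (Integrable.const_mul ?_ _)
      (Integrable.const_mul (CutHolder.majorant_integrableOn a M K hlam1 ha hat.le) _)) _) _
    have i : IntegrableOn (fun s : ℝ => s ^ (-β)) (Ioo 0 t) := by
      simpa using integrableOn_sub_rpow (ρ := -β) (by linarith) 0 t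
    exact i
  -- The majorant D s * E depends only on the constants, so it dominates the integrand for g and for
  -- all its averages alike.
  have bound : ∀ f G : ℝ → ℝ, CutHolder a lam M K f → (∀ x y, |G x - G y| ≤ C * |x - y| ^ lam) →
      ∀ᵐ s ∂volume.restrict (Ioo 0 t), ‖glsIntegrand β f G t s‖ ≤ D s * E := by
    intro f G hf hG
    filter_upwards [ae_restrict_mem measurableSet_Ioo, ae_restrict_of_ae hne] with s hs hsa
    have b1 := hf.abs_weylLeft_le hlam hβ hβ' hβlam hsa hs.1 hs.2.le
    have b2 := abs_weylRight_le hG hC (sub_pos.2 hβ') (by linarith) hβlam' hs.1 hs.2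
    rw [glsIntegrand, norm_neg, norm_mul]
    exact mul_le_mul b1 b2 (norm_nonneg _) ((abs_nonneg _).trans b1)
  have hmeas : ∀ f G : ℝ → ℝ, Measurable f → Measurable G → Measurable (glsIntegrand β f G t) := by
    intro f G hf hG
    exact ((measurable_weylLeft hf β).mul (measurable_weylRight (hG.sub_const _) (1 - β) t)).neg
  refine ⟨hfm, hcut.besovNormTwo_lt_top hlam hlam1 hβlam ha hat.le, ?_, ?_, ?_⟩
  · filter_upwards [ae_restrict_of_ae hne] with s hs
    exact hcut.integrableOn_quotient hlam hβlam hs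
  · exact Integrable.mono' hDi (hmeas _ _ hfm hgc.measurable).aestronglyMeasurable
      (bound _ _ hcut hg)
  set ε : ℕ → ℝ := fun n => 1 / ((n : ℝ) + 1) with hε
  have hε0 : ∀ n, 0 < ε n := fun n => Nat.one_div_pos_of_nat
  set G : ℕ → ℝ → ℝ := fun n => steklov (ε n) g with hG
  have dG : ∀ n x, HasDerivAt (G n) ((ε n)⁻¹ * (g (x + ε n) - g x)) x := fun n x =>
    hasDerivAt_steklov (hε0 n).ne' hgc x
  have hGc : ∀ n, Continuous (G n) := fun n =>
    continuous_iff_continuousAt.2 fun x => (dG n x).continuousAt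
  have hGh : ∀ n x y, |G n x - G n y| ≤ C * |x - y| ^ lam := by
    intro n x y
    have := abs_steklov_sub_le (ε := ε n) (C := C * |x - y| ^ lam) hgc (s := x) (u := y) (c := 1)
      (fun z _ => by simpa using hg (x + ε n * z) (y + ε n * z))
    simpa using this
  have hGR : ∀ n x, |G n x| ≤ R := by
    intro n x
    have := abs_steklov_sub_le (ε := ε n) (C := R) hgc (s := x) (u := x) (c := 0)
      (fun z _ => by simpa using hR (x + ε n * z))
    simpa using this
  have hGt : ∀ x, Tendsto (fun n => G n x) atTop (𝓝 (g x)) := by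
    intro x
    have : ∀ n, G n x = ∫ z in (0 : ℝ)..1, g (x + ε n * z) := fun n => rfl
    simp_rw [this]
    have e : g x = ∫ z in (0 : ℝ)..1, g (x + 0 * z) := by simp
    rw [e]
    refine intervalIntegral.tendsto_integral_filter_of_dominated_convergence (fun _ => R)
      (Eventually.of_forall fun n => ?_) (Eventually.of_forall fun n => ?_) (by simp) ?_
    · exact Continuous.aestronglyMeasurable (by fun_prop)
    · exact ae_of_all _ fun z _ => hR _
    · refine ae_of_all _ fun z _ => (hgc.tendsto _).comp ?_
      exact tendsto_const_nhds.add (tendsto_one_div_add_atTop_nhds_zero_nat.mul_const z)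
  have hcutn : ∀ n, CutHolder a lam M K ((Ici a).indicator fun r => deriv Φ (G n r)) :=
    fun n => hMK (G n) (hGc n).measurable (hGR n) (hGh n)
  have lim : Tendsto (fun n => glsIntegral β ((Ici a).indicator fun r => deriv Φ (G n r)) (G n) t)
      atTop (𝓝 (glsIntegral β ((Ici a).indicator fun r => deriv Φ (g r)) g t)) := by
    refine tendsto_integral_of_dominated_convergence (fun s => D s * E) (fun n => ?_) hDi
      (fun n => bound _ _ (hcutn n) (hGh n)) ?_
    · exact (hmeas _ _ (hcutn n).meas (hGc n).measurable).aestronglyMeasurable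
    · filter_upwards [ae_restrict_of_ae hne] with s hs
      refine Tendsto.neg (Tendsto.mul ?_ ?_)
      · refine CutHolder.tendsto_weylLeft hcutn hlam hβlam (fun r => ?_) hs
        by_cases hr : r ∈ Ici a
        · simp only [indicator_of_mem hr]
          exact (hφ.continuous.tendsto _).comp (hGt r)
        · simp only [indicator_of_notMem hr]
          exact tendsto_const_nhds
      · exact tendsto_weylRight hGh (fun n => (hGc n).measurable) hβlam' hGt s
  have ev : ∀ n, glsIntegral β ((Ici a).indicator fun r => deriv Φ (G n r)) (G n) t =
      Φ (G n t) - Φ (G n a) := fun n =>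
    glsIntegral_of_hasDerivAt hβ hβ' hlam hβlam ha hat hΦ (hcutn n) (dG n) (by fun_prop)
  simp_rw [ev] at lim
  refine tendsto_nhds_unique lim (Tendsto.sub ?_ ?_)
  · exact (hΦ.continuous.tendsto _).comp (hGt t)
  · exact (hΦ.continuous.tendsto _).comp (hGt a)

/-- The same on a time window: the integrand is switched off at time `b`. -/
theorem hasGLSIntegral_Ico {Φ : ℝ → ℝ} (hΦ : ContDiff ℝ 2 Φ) {a b : ℝ} (hβ : 0 < β) (hβ' : β < 1)
    (hlam1 : lam < 1) (hβlam : β < lam) (hβlam' : 1 - β < lam) (ha : 0 ≤ a) (hab : a ≤ b)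
    (hC : 0 ≤ C) (hg : ∀ x y, |g x - g y| ≤ C * |x - y| ^ lam) (hR : ∀ x, |g x| ≤ R) :
    HasGLSIntegral β ((Ico a b).indicator fun r => deriv Φ (g r)) g t
      (Φ (g (min b t)) - Φ (g (min a t))) := by
  -- The window [a, b) is the difference of two half-lines; the values Φ (g t) cancel.
  have h1 := hasGLSIntegral_comp (t := t) hΦ hβ hβ' hlam1 hβlam hβlam' ha hC hg hR
  have h2 := hasGLSIntegral_comp (t := t) hΦ hβ hβ' hlam1 hβlam hβlam' (ha.trans hab) hC hg hR
  convert h1.add (h2.const_mul (-1)) using 1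
  · ext r
    simp only [Pi.add_apply, indicator, mem_Ico, mem_Ici]
    by_cases h3 : a ≤ r <;> by_cases h4 : b ≤ r
    · simp [h3, h4]
    · simp [h3, h4, not_le.1 h4]
    · exact absurd (hab.trans h4) h3
    · simp [h3, h4]
  · ring

theorem memBesovOne_of_holder {γ a : ℝ} (hlam : 0 < lam) (hγ : γ < lam) (hC : 0 ≤ C)
    (hg : ∀ x y, |g x - g y| ≤ C * |x - y| ^ lam) : MemBesovOne γ a t g := by
  have hgc := continuous_of_holder hlam hg
  refine ⟨hgc.measurable.comp measurable_subtype_coe, ?_⟩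
  have hlg : 0 < lam - γ := sub_pos.2 hγ
  refine lt_of_le_of_lt (b := ENNReal.ofReal (C * (t - a) ^ (lam - γ)) +
    ENNReal.ofReal (C * ((t - a) ^ (lam - γ) / (lam - γ)))) ?_ (by simp)
  refine iSup_le fun s => iSup_le fun r => iSup_le fun has => iSup_le fun hsr => iSup_le fun hrt => ?_
  have h0 : 0 < r - s := sub_pos.2 hsr
  have hle : (r - s) ^ (lam - γ) ≤ (t - a) ^ (lam - γ) :=
    Real.rpow_le_rpow h0.le (by linarith) hlg.le
  have q : ∀ u, s < u → |g u - g s| / (u - s) ^ γ ≤ C * (u - s) ^ (lam - γ) := by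
    intro u hu
    have h1 : 0 < u - s := sub_pos.2 hu
    rw [div_le_iff₀ (by positivity), mul_assoc, ← Real.rpow_add h1, sub_add_cancel]
    have := hg u s
    rwa [abs_of_pos h1] at this
  gcongr
  · exact (q r hsr).trans (by gcongr)
  · have i := (integrableOn_sub_rpow (ρ := lam - γ - 1) (by linarith) s r).const_mul C
    calc ∫⁻ u in Ioo s r, ENNReal.ofReal (|g u - g s| / (u - s) ^ (1 + γ))
        ≤ ∫⁻ u in Ioo s r, ENNReal.ofReal (C * (u - s) ^ (lam - γ - 1)) := by
          refine setLIntegral_mono' measurableSet_Ioo fun u hu => ?_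
          refine ENNReal.ofReal_le_ofReal ?_
          have h1 : 0 < u - s := sub_pos.2 hu.1
          have := q u hu.1
          rw [div_le_iff₀ (by positivity)] at this ⊢
          refine this.trans (le_of_eq ?_)
          rw [mul_assoc, mul_assoc, ← Real.rpow_add h1, ← Real.rpow_add h1]
          congr 2
          ring
      _ = ENNReal.ofReal (C * ((r - s) ^ (lam - γ) / (lam - γ))) := by
          rw [← ofReal_integral_eq_lintegral_ofReal i, integral_const_mul,
            setIntegral_sub_rpow (by linarith) hsr.le, sub_add_cancel]
          filter_upwards [ae_restrict_mem measurableSet_Ioo] with u hu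
          have h1 : 0 < u - s := sub_pos.2 hu.1
          simp only [Pi.zero_apply]
          positivity
      _ ≤ _ := by gcongr

end Holder

/-! ### Hölder continuity of Gaussian processes -/

/-- Chaining: x is joined to its dyadic lower approximations p x n, whose increments are summable
geometrically, and at the scale of |x - y| the approximations of x and y coincide or are neighbours.
Continuity passes from the approximations to x itself. -/
theorem holder_of_dyadic {f : ℝ → ℝ} (hf : ContinuousOn f (Icc 0 1)) {lam : ℝ} (hlam : 0 < lam)
    (h : ∀ᶠ n : ℕ in atTop, ∀ k < 2 ^ n,
      |f (((k + 1 : ℕ) : ℝ) / 2 ^ n) - f ((k : ℝ) / 2 ^ n)| ≤ ((1 / 2 : ℝ) ^ lam) ^ n) :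
    ∃ C, 0 ≤ C ∧ ∀ x ∈ Icc (0 : ℝ) 1, ∀ y ∈ Icc (0 : ℝ) 1, |f x - f y| ≤ C * |x - y| ^ lam := by
  set ρ : ℝ := (1 / 2 : ℝ) ^ lam with hρ
  have hρ0 : 0 < ρ := by positivity
  have hρ1 : ρ < 1 := Real.rpow_lt_one (by norm_num) (by norm_num) hlam
  obtain ⟨N, hN⟩ := eventually_atTop.1 h
  set d : ℕ → ℕ → ℝ := fun n k => |f (((k + 1 : ℕ) : ℝ) / 2 ^ n) - f ((k : ℝ) / 2 ^ n)| with hd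
  have hd0 : ∀ n k, 0 ≤ d n k := fun n k => abs_nonneg _
  -- The finitely many levels below N are absorbed into the constant by summing all their normalized
  -- increments.
  obtain ⟨A, hA0, hA⟩ : ∃ A : ℝ, 0 ≤ A ∧ ∀ n, ∀ k < 2 ^ n, d n k ≤ A * ρ ^ n := by
    have hs : 0 ≤ ∑ n ∈ Finset.range N, ∑ k ∈ Finset.range (2 ^ n), d n k / ρ ^ n :=
      Finset.sum_nonneg fun n _ => Finset.sum_nonneg fun k _ => by have := hd0 n k; positivity
    refine ⟨1 + ∑ n ∈ Finset.range N, ∑ k ∈ Finset.range (2 ^ n), d n k / ρ ^ n, by linarith,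
      fun n k hk => ?_⟩
    rcases le_or_gt N n with hn | hn
    · refine (hN n hn k hk).trans (le_mul_of_one_le_left (by positivity) (by linarith))
    · rw [← div_le_iff₀ (by positivity)]
      have h1 : d n k / ρ ^ n ≤ ∑ k ∈ Finset.range (2 ^ n), d n k / ρ ^ n :=
        Finset.single_le_sum (f := fun k => d n k / ρ ^ n)
          (fun k _ => by have := hd0 n k; positivity) (Finset.mem_range.2 hk)
      have h2 : ∑ k ∈ Finset.range (2 ^ n), d n k / ρ ^ n ≤
          ∑ n ∈ Finset.range N, ∑ k ∈ Finset.range (2 ^ n), d n k / ρ ^ n :=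
        Finset.single_le_sum (f := fun n => ∑ k ∈ Finset.range (2 ^ n), d n k / ρ ^ n)
          (fun n _ => Finset.sum_nonneg fun k _ => by have := hd0 n k; positivity)
          (Finset.mem_range.2 hn)
      linarith
  set p : ℝ → ℕ → ℝ := fun x n => (⌊2 ^ n * x⌋₊ : ℝ) / 2 ^ n with hp
  have p_le : ∀ x, 0 ≤ x → ∀ n, p x n ≤ x := by
    intro x hx n
    rw [hp]
    simp only
    rw [div_le_iff₀ (by positivity), mul_comm]
    exact Nat.floor_le (by positivity)
  have lt_p : ∀ x, ∀ n, x - (1 / 2) ^ n ≤ p x n := by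
    intro x n
    have := (Nat.lt_floor_add_one (2 ^ n * x)).le
    rw [hp]
    simp only
    rw [le_div_iff₀ (by positivity), sub_mul, ← mul_pow]
    norm_num
    linarith
  have p_mem : ∀ x ∈ Icc (0 : ℝ) 1, ∀ n, p x n ∈ Icc (0 : ℝ) 1 := fun x hx n =>
    ⟨by positivity, (p_le x hx.1 n).trans hx.2⟩
  have p_tendsto : ∀ x, 0 ≤ x → Tendsto (p x) atTop (𝓝 x) := by
    intro x hx
    refine tendsto_of_tendsto_of_tendsto_of_le_of_le ?_ tendsto_const_nhds (lt_p x) (p_le x hx)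
    have : Tendsto (fun n : ℕ => x - (1 / 2 : ℝ) ^ n) atTop (𝓝 (x - 0)) :=
      tendsto_const_nhds.sub (tendsto_pow_atTop_nhds_zero_of_lt_one (by norm_num) (by norm_num))
    simpa using this
  have step : ∀ x ∈ Icc (0 : ℝ) 1, ∀ n, dist (f (p x n)) (f (p x (n + 1))) ≤ A * ρ * ρ ^ n := by
    intro x hx n
    set j := ⌊2 ^ n * x⌋₊ with hj
    have j1 : (j : ℝ) ≤ 2 ^ n * x := Nat.floor_le (by have := hx.1; positivity)
    have j2 : 2 ^ n * x < j + 1 := Nat.lt_floor_add_one _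
    set i := ⌊2 ^ (n + 1) * x⌋₊ with hi
    have i1 : (i : ℝ) ≤ 2 ^ (n + 1) * x := Nat.floor_le (by have := hx.1; positivity)
    have i2 : 2 ^ (n + 1) * x < i + 1 := Nat.lt_floor_add_one _
    rw [pow_succ] at i1 i2
    have k1 : 2 * j < i + 1 := by
      have : (2 * j : ℝ) < i + 1 := by linarith
      exact_mod_cast this
    have k2 : i < 2 * j + 2 := by
      have : (i : ℝ) < 2 * j + 2 := by linarith
      exact_mod_cast this
    have e : p x n = ((2 * j : ℕ) : ℝ) / 2 ^ (n + 1) := by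
      simp only [hp, ← hj]
      push_cast
      rw [pow_succ]
      field_simp
    rw [e]
    change dist (f _) (f ((i : ℝ) / 2 ^ (n + 1))) ≤ _
    rcases (show i = 2 * j ∨ i = 2 * j + 1 by omega) with h | h
    · rw [h, dist_self]
      positivity
    · rw [h, dist_comm, Real.dist_eq]
      refine (hA (n + 1) (2 * j) ?_).trans (le_of_eq (by ring))
      have : (i : ℝ) ≤ 2 ^ (n + 1) := by
        rw [pow_succ]
        refine i1.trans ?_
        have := hx.2
        have : (2 : ℝ) ^ n * 2 * x ≤ 2 ^ n * 2 * 1 := by gcongr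
        linarith
      have : i ≤ 2 ^ (n + 1) := by exact_mod_cast this
      omega
  have approx : ∀ x ∈ Icc (0 : ℝ) 1, ∀ n, |f (p x n) - f x| ≤ A * ρ * ρ ^ n / (1 - ρ) := by
    intro x hx n
    refine dist_le_of_le_geometric_of_tendsto ρ (A * ρ) hρ1 (step x hx) ?_ n
    refine (hf x hx).tendsto.comp (tendsto_nhdsWithin_iff.2 ⟨p_tendsto x hx.1, ?_⟩)
    exact Eventually.of_forall (p_mem x hx)
  have h1ρ : 0 < 1 - ρ := sub_pos.2 hρ1
  set B : ℝ := A * ρ / (1 - ρ) + A + A * ρ / (1 - ρ) with hB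
  have hB0 : 0 ≤ B := by positivity
  have main : ∀ x ∈ Icc (0 : ℝ) 1, ∀ y ∈ Icc (0 : ℝ) 1, x < y →
      |f x - f y| ≤ B * 2 ^ lam * |x - y| ^ lam := by
    intro x hx y hy hxy
    -- The scale n satisfies (1/2)^(n+1) < y - x ≤ (1/2)^n.
    obtain ⟨n, hn1, hn2⟩ := exists_nat_pow_near_of_lt_one (sub_pos.2 hxy)
      (by linarith [hx.1, hy.2]) (by norm_num : (0 : ℝ) < 1 / 2) (by norm_num)
    have mid : |f (p x n) - f (p y n)| ≤ A * ρ ^ n := by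
      set j := ⌊2 ^ n * x⌋₊ with hj
      set i := ⌊2 ^ n * y⌋₊ with hi
      have j2 : 2 ^ n * x < j + 1 := Nat.lt_floor_add_one _
      have i1 : (i : ℝ) ≤ 2 ^ n * y := Nat.floor_le (by have := hy.1; positivity)
      have hji : j ≤ i := Nat.floor_mono (by gcongr)
      have hlt : i < j + 2 := by
        have e : (2 : ℝ) ^ n * (1 / 2) ^ n = 1 := by rw [← mul_pow]; norm_num
        have : (2 : ℝ) ^ n * (y - x) ≤ 2 ^ n * (1 / 2) ^ n := by gcongr
        have : (i : ℝ) < j + 2 := by linarith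
        exact_mod_cast this
      change |f ((j : ℝ) / 2 ^ n) - f ((i : ℝ) / 2 ^ n)| ≤ _
      rcases (show i = j ∨ i = j + 1 by omega) with h | h
      · rw [h, sub_self, abs_zero]
        positivity
      · rw [h, abs_sub_comm]
        refine hA n j ?_
        have : (i : ℝ) ≤ 2 ^ n := by
          refine i1.trans ?_
          have := hy.2
          exact mul_le_of_le_one_right (by positivity) this
        have : i ≤ 2 ^ n := by exact_mod_cast this
        omega
    have tri : |f x - f y| ≤ |f (p x n) - f x| + |f (p x n) - f (p y n)| + |f (p y n) - f y| := by
      rw [abs_sub_comm (f (p x n)) (f x)]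
      have := abs_sub_le (f x) (f (p x n)) (f y)
      have := abs_sub_le (f (p x n)) (f (p y n)) (f y)
      linarith
    have h3 : |f x - f y| ≤ B * ρ ^ n := by
      refine tri.trans ((add_le_add (add_le_add (approx x hx n) mid) (approx y hy n)).trans
        (le_of_eq ?_))
      rw [hB]
      ring
    have h4 : ρ ^ n ≤ 2 ^ lam * |x - y| ^ lam := by
      rw [abs_sub_comm, abs_of_pos (sub_pos.2 hxy), ← Real.mul_rpow (by norm_num)
        (sub_pos.2 hxy).le, hρ, ← Real.rpow_natCast, ← Real.rpow_mul (by norm_num), mul_comm lam,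
        Real.rpow_mul (by norm_num), Real.rpow_natCast]
      refine Real.rpow_le_rpow (by positivity) ?_ hlam.le
      rw [pow_succ] at hn1
      linarith
    calc |f x - f y| ≤ B * ρ ^ n := h3
      _ ≤ B * (2 ^ lam * |x - y| ^ lam) := by gcongr
      _ = _ := by ring
  refine ⟨B * 2 ^ lam, by positivity, fun x hx y hy => ?_⟩
  rcases lt_trichotomy x y with h | h | h
  · exact main x hx y hy h
  · rw [h, sub_self, abs_zero]
    positivity
  · rw [abs_sub_comm, abs_sub_comm x y]
    exact main y hy x hx h

variable {Ω : Type*} {m : MeasurableSpace Ω} {μ : Measure Ω}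

/-- The Chernoff bound exp(-x²/(2w)) for each tail, weakened by exp y ≥ y^k / k! to a power law.
Only an upper bound w on the variance enters, so degenerate variables are covered. -/
theorem measure_le_abs_of_hasGaussianLaw {Z : Ω → ℝ} (hZ : HasGaussianLaw Z μ)
    (h0 : ∫ ω, Z ω ∂μ = 0) {w x : ℝ} (hw : 0 < w) (hZw : ∫ ω, Z ω ^ 2 ∂μ ≤ w) (hx : 0 < x)
    (k : ℕ) : μ {ω | x ≤ |Z ω|} ≤ ENNReal.ofReal (2 * k.factorial * (2 * w / x ^ 2) ^ k) := by
  have := hZ.isProbabilityMeasure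
  have hmap := hZ.map_eq_gaussianReal
  rw [h0, variance_of_integral_eq_zero hZ.aemeasurable h0] at hmap
  have hsub : HasSubgaussianMGF Z w.toNNReal μ := by
    refine ⟨fun t => ?_, fun t => ?_⟩
    · have := integrable_exp_mul_gaussianReal (μ := 0) (v := (∫ ω, Z ω ^ 2 ∂μ).toNNReal) t
      rw [← hmap, integrable_map_measure (by fun_prop) hZ.aemeasurable] at this
      exact this
    · rw [mgf_gaussianReal hmap, zero_mul, zero_add]
      have : (∫ ω, Z ω ^ 2 ∂μ).toNNReal ≤ w.toNNReal := Real.toNNReal_le_toNNReal hZw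
      gcongr
  set y : ℝ := x ^ 2 / (2 * w) with hy
  have hy0 : 0 < y := by positivity
  have hexp : Real.exp (-y) ≤ k.factorial * (2 * w / x ^ 2) ^ k := by
    have h1 := Real.pow_div_factorial_le_exp y hy0.le k
    rw [Real.exp_neg]
    have h2 : (k.factorial : ℝ) * (2 * w / x ^ 2) ^ k = (y ^ k / k.factorial)⁻¹ := by
      rw [inv_div, div_eq_mul_inv _ (y ^ k), ← inv_pow, hy, inv_div]
    rw [h2]
    exact inv_anti₀ (by positivity) h1
  have t1 := hsub.measure_ge_le hx.le
  have t2 := hsub.neg.measure_ge_le hx.le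
  rw [Real.coe_toNNReal _ hw.le, neg_div] at t1 t2
  have hsubset : {ω | x ≤ |Z ω|} ⊆ {ω | x ≤ Z ω} ∪ {ω | x ≤ (-Z) ω} := by
    intro ω hω
    exact le_abs.1 (show x ≤ |Z ω| from hω)
  calc μ {ω | x ≤ |Z ω|} ≤ μ {ω | x ≤ Z ω} + μ {ω | x ≤ (-Z) ω} :=
        (measure_mono hsubset).trans (measure_union_le _ _)
    _ = ENNReal.ofReal (μ.real {ω | x ≤ Z ω} + μ.real {ω | x ≤ (-Z) ω}) := by
        rw [ENNReal.ofReal_add measureReal_nonneg measureReal_nonneg, ofReal_measureReal,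
          ofReal_measureReal]
    _ ≤ _ := by
        refine ENNReal.ofReal_le_ofReal ?_
        linarith

/-- The **Kolmogorov–Chentsov** theorem for continuous centered processes with Gaussian
increments. -/
theorem ae_holder_of_gaussian_increments {Y : ℝ → Ω → ℝ}
    (hY : ∀ s ∈ Icc (0 : ℝ) 1, ∀ t ∈ Icc (0 : ℝ) 1, HasGaussianLaw (fun ω => Y t ω - Y s ω) μ)
    (h0 : ∀ s ∈ Icc (0 : ℝ) 1, ∀ t ∈ Icc (0 : ℝ) 1, ∫ ω, (Y t ω - Y s ω) ∂μ = 0)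
    (hc : ∀ᵐ ω ∂μ, ContinuousOn (fun t => Y t ω) (Icc 0 1)) {C α lam : ℝ} (hC : 0 < C)
    (hlam : 0 < lam) (hα : lam < α)
    (hv : ∀ s ∈ Icc (0 : ℝ) 1, ∀ t ∈ Icc (0 : ℝ) 1, s ≤ t →
      ∫ ω, (Y t ω - Y s ω) ^ 2 ∂μ ≤ C * (t - s) ^ (2 * α)) :
    ∀ᵐ ω ∂μ, ∃ C, 0 ≤ C ∧ ∀ s ∈ Icc (0 : ℝ) 1, ∀ t ∈ Icc (0 : ℝ) 1,
      |Y s ω - Y t ω| ≤ C * |s - t| ^ lam := by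
  -- With k (α - lam) ≥ 1 a single dyadic increment of level n is too large with probability at most
  -- A 4⁻ⁿ; over 2ⁿ increments this gives A 2⁻ⁿ, which is summable.
  obtain ⟨k, hk⟩ := exists_nat_ge (1 / (α - lam))
  have hαl : 0 < α - lam := sub_pos.2 hα
  have hk1 : 1 ≤ k * (α - lam) := by rwa [div_le_iff₀ hαl] at hk
  set A : ℝ := 2 * k.factorial * (2 * C) ^ k with hA
  have hA0 : 0 < A := by positivity
  set ρ : ℝ := (1 / 2 : ℝ) ^ lam with hρ
  have hρ0 : 0 < ρ := by positivity
  set S : ℕ → Set Ω := fun n => ⋃ j ∈ Finset.range (2 ^ n),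
    {ω | ρ ^ n ≤ |Y (((j + 1 : ℕ) : ℝ) / 2 ^ n) ω - Y ((j : ℝ) / 2 ^ n) ω|} with hS
  have hSle : ∀ n, μ (S n) ≤ ENNReal.ofReal (A * (1 / 2) ^ n) := by
    intro n
    have hone : ∀ j ∈ Finset.range (2 ^ n),
        μ {ω | ρ ^ n ≤ |Y (((j + 1 : ℕ) : ℝ) / 2 ^ n) ω - Y ((j : ℝ) / 2 ^ n) ω|} ≤
          ENNReal.ofReal (A * ((1 / 2) ^ n) ^ 2) := by
      intro j hj
      have hj : j + 1 ≤ 2 ^ n := Finset.mem_range.1 hj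
      have hj' : ((j + 1 : ℕ) : ℝ) ≤ 2 ^ n := by exact_mod_cast hj
      have m1 : ((j + 1 : ℕ) : ℝ) / 2 ^ n ∈ Icc (0 : ℝ) 1 :=
        ⟨by positivity, (div_le_one (by positivity)).2 hj'⟩
      have m0 : (j : ℝ) / 2 ^ n ∈ Icc (0 : ℝ) 1 := by
        refine ⟨by positivity, (div_le_one (by positivity)).2 (le_trans ?_ hj')⟩
        push_cast
        linarith
      have hd : ((j + 1 : ℕ) : ℝ) / 2 ^ n - (j : ℝ) / 2 ^ n = (1 / 2) ^ n := by
        push_cast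
        rw [div_sub_div_same, add_sub_cancel_left, one_div_pow]
      have hle : (j : ℝ) / 2 ^ n ≤ ((j + 1 : ℕ) : ℝ) / 2 ^ n := by
        rw [← sub_nonneg, hd]
        positivity
      have hv1 := hv _ m0 _ m1 hle
      rw [hd] at hv1
      have hn : (0 : ℝ) < (1 / 2) ^ n := by positivity
      refine (measure_le_abs_of_hasGaussianLaw (hY _ m0 _ m1) (h0 _ m0 _ m1) (by positivity) hv1
        (by positivity : 0 < ρ ^ n) k).trans (ENNReal.ofReal_le_ofReal ?_)
      rw [hA, mul_assoc (2 * (k.factorial : ℝ))]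
      gcongr
      have e1 : ρ ^ n = ((1 / 2 : ℝ) ^ n) ^ lam := by
        rw [hρ, ← Real.rpow_natCast, ← Real.rpow_mul (by norm_num), mul_comm,
          Real.rpow_mul (by norm_num), Real.rpow_natCast]
      set z : ℝ := (1 / 2 : ℝ) ^ n with hz
      have e2 : 2 * (C * z ^ (2 * α)) / (ρ ^ n) ^ 2 = 2 * C * z ^ (2 * (α - lam)) := by
        rw [e1, ← Real.rpow_natCast, ← Real.rpow_mul hn.le, ← mul_assoc, mul_div_assoc,
          ← Real.rpow_sub hn]
        congr 2
        push_cast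
        ring
      rw [e2, mul_pow]
      gcongr
      rw [← Real.rpow_natCast, ← Real.rpow_natCast, ← Real.rpow_mul hn.le]
      refine Real.rpow_le_rpow_of_exponent_ge hn ?_ ?_
      · exact pow_le_one₀ (by norm_num) (by norm_num)
      · push_cast
        linarith
    calc μ (S n) ≤ ∑ j ∈ Finset.range (2 ^ n), ENNReal.ofReal (A * ((1 / 2) ^ n) ^ 2) :=
          (measure_biUnion_finset_le _ _).trans (Finset.sum_le_sum hone)
      _ = ENNReal.ofReal (A * (1 / 2) ^ n) := by
          rw [Finset.sum_const, Finset.card_range, nsmul_eq_mul, ← ENNReal.ofReal_natCast,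
            ← ENNReal.ofReal_mul (by positivity)]
          congr 1
          push_cast
          have : (2 : ℝ) ^ n * (1 / 2) ^ n = 1 := by rw [← mul_pow]; norm_num
          linear_combination A * (1 / 2) ^ n * this
  have hsum : ∑' n, μ (S n) ≠ ⊤ := by
    refine ne_top_of_le_ne_top ?_ (ENNReal.tsum_le_tsum hSle)
    rw [← ENNReal.ofReal_tsum_of_nonneg (fun n => by positivity)
      ((summable_geometric_of_lt_one (by norm_num) (by norm_num)).mul_left A)]
    exact ENNReal.ofReal_ne_top
  filter_upwards [ae_eventually_notMem hsum, hc] with ω hω hcω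
  refine holder_of_dyadic hcω hlam ?_
  filter_upwards [hω] with n hn j hj
  by_contra hcon
  exact hn (mem_biUnion (Finset.mem_coe.2 (Finset.mem_range.2 hj)) (not_le.1 hcon).le)

/-! ### Steering the integral along a path -/

/-- A smooth function that vanishes at `0` and is `1` outside `(-ε, ε)`. -/
def cutoff (ε x : ℝ) : ℝ := Real.smoothTransition (x ^ 2 / ε ^ 2)

theorem contDiff_cutoff (ε : ℝ) : ContDiff ℝ 2 (cutoff ε) :=
  (Real.smoothTransition.contDiff (n := 2)).comp ((contDiff_id.pow 2).div_const _)

theorem cutoff_zero (ε : ℝ) : cutoff ε 0 = 0 := by simp [cutoff]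

theorem cutoff_nonneg (ε x : ℝ) : 0 ≤ cutoff ε x := Real.smoothTransition.nonneg _

theorem cutoff_le_one (ε x : ℝ) : cutoff ε x ≤ 1 := Real.smoothTransition.le_one _

theorem cutoff_of_le {ε x : ℝ} (hε : 0 < ε) (hx : ε ≤ |x|) : cutoff ε x = 1 := by
  refine Real.smoothTransition.one_of_one_le ?_
  rw [one_le_div (by positivity), ← sq_abs x]
  gcongr

/-- The values at the times `n` of the integral that is steered towards `ξ n` during the `n`-th
time step, where `x` are the values of the integrator. -/
def steer (F : ℕ → ℝ → ℝ) (ξ x : ℕ → ℝ) : ℕ → ℝ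
  | 0 => 0
  | n + 1 => steer F ξ x n + (ξ n - steer F ξ x n) * F n (x (n + 1) - x n)

/-- The integrand that steers the integral with respect to the path `g` towards `ξ n` during the
time interval `[τ n, τ (n + 1))`. -/
def steeringIntegrand (F : ℕ → ℝ → ℝ) (τ ξ : ℕ → ℝ) (g : ℝ → ℝ) (r : ℝ) : ℝ :=
  ∑' k, (Ico (τ k) (τ (k + 1))).indicator
    (fun r => (ξ k - steer F ξ (fun n => g (τ n)) k) * deriv (F k) (g r - g (τ k))) r

section Pathwise

variable {F : ℕ → ℝ → ℝ} {τ ξ : ℕ → ℝ} {g : ℝ → ℝ} {T : ℝ}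

theorem steeringIntegrand_eq_sum (hτ : Monotone τ) {r : ℝ} {N : ℕ} (hr : r < τ N) :
    steeringIntegrand F τ ξ g r = ∑ k ∈ Finset.range N, (Ico (τ k) (τ (k + 1))).indicator
      (fun r => (ξ k - steer F ξ (fun n => g (τ n)) k) * deriv (F k) (g r - g (τ k))) r := by
  refine tsum_eq_sum fun k hk => indicator_of_notMem (fun h => ?_) _
  exact absurd (hr.trans_le (hτ (not_lt.1 (by simpa using hk)))) (not_lt.2 h.1)

/-- Every window ends before T. At time T itself this settles adaptedness. -/
theorem steeringIntegrand_of_le (hτT : ∀ n, τ n < T) {r : ℝ} (hr : T ≤ r) :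
    steeringIntegrand F τ ξ g r = 0 := by
  unfold steeringIntegrand
  rw [← tsum_zero (β := ℕ)]
  refine tsum_congr fun k => indicator_of_notMem (fun h => ?_) _
  exact absurd (h.2.trans (hτT _)) (not_lt.2 hr)

theorem exists_mem_Ico_of_tendsto (hτlim : Tendsto τ atTop (𝓝 T)) {s : ℝ} {N : ℕ} (hs : τ N ≤ s)
    (hsT : s < T) : ∃ n ≥ N, s ∈ Ico (τ n) (τ (n + 1)) := by
  classical
  have hex : ∃ m, s < τ (N + m + 1) := by
    obtain ⟨M, hM⟩ := eventually_atTop.1 (hτlim.eventually (lt_mem_nhds hsT))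
    exact ⟨M, hM _ (by omega)⟩
  refine ⟨N + Nat.find hex, by omega, ?_, Nat.find_spec hex⟩
  rcases h : Nat.find hex with _ | m
  · simpa using hs
  · exact not_lt.1 (Nat.find_min hex (m := m) (by omega))

variable {β lam C : ℝ}

/-- Compose with the projection onto [p, q], which is 1-Lipschitz. The chain rule asks for a
globally Hölder bounded integrator, whereas a path is controlled only near T. -/
theorem exists_holder_extension {p q : ℝ} (hpq : p ≤ q) (hlam : 0 ≤ lam) (hC : 0 ≤ C)
    (hg : ∀ s ∈ Icc p q, ∀ t ∈ Icc p q, |g s - g t| ≤ C * |s - t| ^ lam) :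
    ∃ (G : ℝ → ℝ) (R : ℝ), (∀ s ∈ Icc p q, G s = g s) ∧
      (∀ x y, |G x - G y| ≤ C * |x - y| ^ lam) ∧ ∀ x, |G x| ≤ R := by
  have hmem : ∀ x, max p (min q x) ∈ Icc p q := fun x =>
    ⟨le_max_left _ _, max_le hpq (min_le_left _ _)⟩
  refine ⟨fun x => g (max p (min q x)), |g p| + C * (q - p) ^ lam, fun s hs => ?_,
    fun x y => ?_, fun x => ?_⟩
  · simp only
    rw [min_eq_right hs.2, max_eq_right hs.1]
  · refine (hg _ (hmem x) _ (hmem y)).trans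
      (mul_le_mul_of_nonneg_left (Real.rpow_le_rpow (abs_nonneg _) ?_ hlam) hC)
    refine (abs_max_sub_max_le_max p (min q x) p (min q y)).trans ?_
    rw [sub_self, abs_zero, max_eq_right (abs_nonneg _)]
    refine (abs_min_sub_min_le_max q x q y).trans ?_
    rw [sub_self, abs_zero, max_eq_right (abs_nonneg _)]
  · have h1 := hg _ (hmem x) p (left_mem_Icc.2 hpq)
    have h2 : |max p (min q x) - p| ^ lam ≤ (q - p) ^ lam := by
      refine Real.rpow_le_rpow (abs_nonneg _) ?_ hlam
      rw [abs_of_nonneg (sub_nonneg.2 (hmem x).1)]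
      linarith [(hmem x).2]
    have h3 := abs_sub_abs_le_abs_sub (g (max p (min q x))) (g p)
    have h4 : C * |max p (min q x) - p| ^ lam ≤ C * (q - p) ^ lam := by gcongr
    linarith

/-- The vanishing term F k (x k - x k) is kept so that the summands match the chain rule over
completed windows. -/
theorem steer_eq_sum (hF0 : ∀ n, F n 0 = 0) (x : ℕ → ℝ) (n : ℕ) :
    steer F ξ x n = ∑ k ∈ Finset.range n,
      (ξ k - steer F ξ x k) * (F k (x (k + 1) - x k) - F k (x k - x k)) := by
  induction n with
  | zero => simp [steer]
  | succ n ih =>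
    rw [Finset.sum_range_succ, ← ih, steer, sub_self, hF0, sub_zero]

/-- Up to a time s < τ N the integrand is a finite combination of window integrands with
coefficients fixed along the path, so linearity and the chain rule apply to the extension of g. The
clamp `max (τ 0)` keeps g on the interval where it is controlled; for s < τ 0 all terms vanish. -/
theorem steeringIntegrand_glsExists_and_eq (hF : ∀ n, ContDiff ℝ 2 (F n)) (hτ : StrictMono τ)
    (hτT : ∀ n, τ n < T) (hτlim : Tendsto τ atTop (𝓝 T))
    (hτ0 : 0 ≤ τ 0) (hβ : 0 < β) (hβ' : β < 1) (hlam1 : lam < 1)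
    (hβlam : β < lam) (hβlam' : 1 - β < lam) (hC : 0 ≤ C)
    (hg : ∀ s ∈ Icc (τ 0) T, ∀ t ∈ Icc (τ 0) T, |g s - g t| ≤ C * |s - t| ^ lam) {s : ℝ}
    (hs : s ∈ Ico 0 T) :
    GLSExists β (steeringIntegrand F τ ξ g) g s ∧ ∀ N, s < τ N →
      glsIntegral β (steeringIntegrand F τ ξ g) g s = ∑ k ∈ Finset.range N,
        (ξ k - steer F ξ (fun n => g (τ n)) k) *
          (F k (g (max (τ 0) (min (τ (k + 1)) s)) - g (τ k)) -
            F k (g (max (τ 0) (min (τ k) s)) - g (τ k))) := by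
  have hlam : 0 < lam := hβ.trans hβlam
  obtain ⟨G, R, hGg, hG, hR⟩ := exists_holder_extension (hτT 0).le hlam.le hC hg
  have hτm := hτ.monotone
  have hτ0k : ∀ k, τ 0 ≤ τ k := fun k => hτm (Nat.zero_le k)
  set c : ℕ → ℝ := fun k => ξ k - steer F ξ (fun n => g (τ n)) k with hc
  set f : ℕ → ℝ → ℝ := fun N r => ∑ k ∈ Finset.range N, c k * (Ico (τ k) (τ (k + 1))).indicator
    (fun r => deriv (fun x => F k (x - g (τ k))) (G r)) r with hf
  have hint : ∀ N, HasGLSIntegral β (f N) G s (∑ k ∈ Finset.range N,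
      c k * (F k (G (min (τ (k + 1)) s) - g (τ k)) - F k (G (min (τ k) s) - g (τ k)))) := by
    intro N
    refine HasGLSIntegral.sum _ fun k _ => HasGLSIntegral.const_mul ?_ _
    exact hasGLSIntegral_Ico (Φ := fun x => F k (x - g (τ k)))
      ((hF k).comp (contDiff_id.sub contDiff_const)) hβ hβ' hlam1 hβlam hβlam'
      (hτ0.trans (hτ0k k)) (hτ k.lt_succ_self).le hC hG hR
  have hψf : ∀ N r, r < τ N → steeringIntegrand F τ ξ g r = f N r := by
    intro N r hr
    rw [steeringIntegrand_eq_sum hτm hr]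
    refine Finset.sum_congr rfl fun k _ => ?_
    by_cases hk : r ∈ Ico (τ k) (τ (k + 1))
    · rw [indicator_of_mem hk, indicator_of_mem hk, deriv_comp_sub_const,
        hGg r ⟨(hτ0k k).trans hk.1, (hk.2.trans (hτT _)).le⟩]
    · rw [indicator_of_notMem hk, indicator_of_notMem hk, mul_zero]
  have hψ0 : ∀ r, r < τ 0 → steeringIntegrand F τ ξ g r = 0 := by
    intro r hr
    rw [steeringIntegrand_eq_sum hτm hr]
    simp
  obtain ⟨N₀, hN₀⟩ := (hτlim.eventually (lt_mem_nhds hs.2)).exists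
  have hgG : ∀ r ∈ Icc (τ 0) s, g r = G r := fun r hr => (hGg r ⟨hr.1, hr.2.trans hs.2.le⟩).symm
  have hψ0' : ∀ r ∈ Ico 0 (τ 0), steeringIntegrand F τ ξ g r = 0 := fun r hr => hψ0 r hr.2
  refine ⟨⟨⟨?_, ?_⟩, ?_, ?_⟩, fun N hN => ?_⟩
  · have : (fun r : Icc (0 : ℝ) s => steeringIntegrand F τ ξ g r) = fun r : Icc (0 : ℝ) s =>
        f N₀ r := by
      ext r
      exact hψf N₀ r (r.2.2.trans_lt hN₀)
    rw [this]
    exact (hint N₀).meas.comp measurable_subtype_coe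
  · rw [besovNormTwo_congr fun r hr => hψf N₀ r (hr.2.trans hN₀)]
    exact (hint N₀).norm_lt_top
  · rcases lt_or_ge s (τ 0) with h | h
    · refine ⟨s, right_mem_Icc.2 hs.1, fun r hr => hψ0 r (hr.2.trans h), ?_, ?_⟩
      · have : Subsingleton (Icc s s) := by rw [Icc_self]; infer_instance
        exact Subsingleton.measurable
      · refine lt_of_le_of_lt (b := 0) ?_ ENNReal.zero_lt_top
        refine iSup_le fun x => iSup_le fun y => iSup_le fun hx => iSup_le fun hxy =>
          iSup_le fun hy => ?_
        exact absurd (hx.trans_lt (hxy.trans_le hy)) (lt_irrefl _)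
    · refine ⟨τ 0, ⟨hτ0, h⟩, hψ0', ?_, ?_⟩
      · have : (fun r : Icc (τ 0) s => g r) = fun r : Icc (τ 0) s => G r := by
          ext r
          exact hgG r r.2
        rw [this]
        exact (continuous_of_holder hlam hG).measurable.comp measurable_subtype_coe
      · refine lt_of_le_of_lt (le_of_eq ?_)
          (memBesovOne_of_holder (a := τ 0) (t := s) hlam hβlam' hC hG).2
        unfold besovNormOne
        refine iSup_congr fun x => iSup_congr fun y => iSup_congr fun hx => iSup_congr fun hxy =>
          iSup_congr fun hy => ?_
        rw [hgG x ⟨hx, hxy.le.trans hy⟩, hgG y ⟨hx.trans hxy.le, hy⟩]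
        congr 1
        refine setLIntegral_congr_fun measurableSet_Ioo fun u hu => ?_
        rw [hgG u ⟨hx.trans hu.1.le, hu.2.le.trans hy⟩]
  · exact (hint N₀).integrable.congr_fun (fun r hr => (glsIntegrand_congr (a := τ 0)
      (fun r hr => hψf N₀ r (hr.2.trans hN₀)) hψ0' hgG hr).symm) measurableSet_Ioo
  · rw [glsIntegral_congr (a := τ 0) (fun r hr => hψf N r (hr.2.trans hN)) hψ0' hgG, (hint N).eq]
    refine Finset.sum_congr rfl fun k _ => ?_
    rcases lt_or_ge s (τ 0) with h | h
    · rw [min_eq_right (h.le.trans (hτ0k _)), min_eq_right (h.le.trans (hτ0k _)), sub_self,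
        sub_self]
    · rw [max_eq_right (le_min (hτ0k _) h), max_eq_right (le_min (hτ0k _) h),
        hGg _ ⟨le_min (hτ0k _) h, (min_le_left _ _).trans (hτT _).le⟩,
        hGg _ ⟨le_min (hτ0k _) h, (min_le_left _ _).trans (hτT _).le⟩]

theorem glsIntegral_steeringIntegrand (hF : ∀ n, ContDiff ℝ 2 (F n)) (hF0 : ∀ n, F n 0 = 0)
    (hτ : StrictMono τ) (hτT : ∀ n, τ n < T) (hτlim : Tendsto τ atTop (𝓝 T))
    (hτ0 : 0 ≤ τ 0) (hβ : 0 < β) (hβ' : β < 1) (hlam1 : lam < 1)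
    (hβlam : β < lam) (hβlam' : 1 - β < lam) (hC : 0 ≤ C)
    (hg : ∀ s ∈ Icc (τ 0) T, ∀ t ∈ Icc (τ 0) T, |g s - g t| ≤ C * |s - t| ^ lam) {s : ℝ} {n : ℕ}
    (hs : s ∈ Ico (τ n) (τ (n + 1))) :
    glsIntegral β (steeringIntegrand F τ ξ g) g s =
      steer F ξ (fun n => g (τ n)) n +
        (ξ n - steer F ξ (fun n => g (τ n)) n) * F n (g s - g (τ n)) := by
  have hτm := hτ.monotone
  have hτ0k : ∀ k, τ 0 ≤ τ k := fun k => hτm (Nat.zero_le k)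
  rw [(steeringIntegrand_glsExists_and_eq hF hτ hτT hτlim hτ0 hβ hβ' hlam1 hβlam hβlam' hC hg
    ⟨hτ0.trans ((hτ0k n).trans hs.1), hs.2.trans (hτT _)⟩).2 (n + 1) hs.2,
    Finset.sum_range_succ, steer_eq_sum hF0 _ n]
  congr 1
  · refine Finset.sum_congr rfl fun k hk => ?_
    have h1 : τ (k + 1) ≤ s := (hτm (Finset.mem_range.1 hk)).trans hs.1
    rw [min_eq_left h1, min_eq_left ((hτm k.le_succ).trans h1), max_eq_right (hτ0k _),
      max_eq_right (hτ0k _)]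
  · rw [min_eq_right hs.2.le, min_eq_left hs.1, max_eq_right (hτ0k _),
      max_eq_right ((hτ0k n).trans hs.1), sub_self, hF0, sub_zero, ← steer_eq_sum hF0 _ n]

/-- Once every window hits its target, v (n+1) = ξ n, so v has the limit of ξ. Between the grid
times the integral lies on the segment from v n to ξ n. -/
theorem tendsto_glsIntegral_steeringIntegrand (hF : ∀ n, ContDiff ℝ 2 (F n))
    (hF0 : ∀ n, F n 0 = 0) (hF1 : ∀ n x, F n x ∈ Icc (0 : ℝ) 1)
    (hτ : StrictMono τ) (hτT : ∀ n, τ n < T) (hτlim : Tendsto τ atTop (𝓝 T))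
    (hτ0 : 0 ≤ τ 0) (hβ : 0 < β) (hβ' : β < 1) (hlam1 : lam < 1)
    (hβlam : β < lam) (hβlam' : 1 - β < lam) (hC : 0 ≤ C)
    (hg : ∀ s ∈ Icc (τ 0) T, ∀ t ∈ Icc (τ 0) T, |g s - g t| ≤ C * |s - t| ^ lam)
    (hhit : ∀ᶠ n in atTop, F n (g (τ (n + 1)) - g (τ n)) = 1) {x : ℝ}
    (hξ : Tendsto ξ atTop (𝓝 x)) :
    Tendsto (fun s => glsIntegral β (steeringIntegrand F τ ξ g) g s) (𝓝[<] T) (𝓝 x) := by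
  set v : ℕ → ℝ := steer F ξ fun n => g (τ n) with hv
  have hvlim : Tendsto v atTop (𝓝 x) := by
    rw [← tendsto_add_atTop_iff_nat 1]
    refine hξ.congr' ?_
    filter_upwards [hhit] with n hn
    rw [hv, steer, hn]
    ring
  rw [Metric.tendsto_nhds]
  intro ε hε
  obtain ⟨N, hN⟩ := eventually_atTop.1
    ((Metric.tendsto_nhds.1 hvlim ε hε).and (Metric.tendsto_nhds.1 hξ ε hε))
  filter_upwards [Ico_mem_nhdsLT (hτT N)] with s hs
  obtain ⟨n, hn, hsn⟩ := exists_mem_Ico_of_tendsto hτlim hs.1 hs.2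
  rw [glsIntegral_steeringIntegrand hF hF0 hτ hτT hτlim hτ0 hβ hβ' hlam1 hβlam hβlam' hC hg hsn]
  obtain ⟨h1, h2⟩ := hN n hn
  obtain ⟨hw0, hw1⟩ := hF1 n (g s - g (τ n))
  -- F n takes values in [0, 1], so a ball containing v n and ξ n contains the integral.
  have := (convex_ball x ε) (x := v n) h1 (y := ξ n) h2 (sub_nonneg.2 hw1) hw0 (by ring)
  rw [Metric.mem_ball] at this
  convert this using 2
  simp only [smul_eq_mul]
  ring

end Pathwise

/-! ### The representation theorem -/

section Representation

variable {Ω : Type*} {m : MeasurableSpace Ω} {μ : Measure Ω} {X : ℝ → Ω → ℝ} {α T : ℝ}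

theorem ClassX.hasGaussianLaw_sub (hX : ClassX μ X α T) {s t : ℝ} (hs : s ∈ Icc 0 T)
    (ht : t ∈ Icc 0 T) : HasGaussianLaw (fun ω => X t ω - X s ω) μ :=
  hX.gaussian.hasGaussianLaw_fun_sub (s := ⟨t, ht⟩) (t := ⟨s, hs⟩)

theorem ClassX.integral_sub (hX : ClassX μ X α T) {s t : ℝ} (hs : s ∈ Icc 0 T)
    (ht : t ∈ Icc 0 T) : ∫ ω, (X t ω - X s ω) ∂μ = 0 := by
  rw [MeasureTheory.integral_sub (hX.gaussian.hasGaussianLaw_eval ⟨t, ht⟩).integrable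
    (hX.gaussian.hasGaussianLaw_eval ⟨s, hs⟩).integrable, hX.centered t ht, hX.centered s hs,
    sub_zero]

theorem CovarianceConditions.exists_integral_sq_le {u : ℝ}
    (hcov : CovarianceConditions μ (shiftedIncrement X u) (T - u) α) :
    ∃ C, 0 < C ∧ ∀ s t, u ≤ s → s ≤ t → t ≤ T →
      ∫ ω, (X t ω - X s ω) ^ 2 ∂μ ≤ C * (t - s) ^ (2 * α) := by
  obtain ⟨C, hC, h⟩ := hcov.worst_le
  refine ⟨C, hC, fun s t hus hst htT => ?_⟩
  have hst' : 0 ≤ t - s := sub_nonneg.2 hst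
  have h1 := h (t - s) ⟨hst', by linarith⟩
  have h2 : ENNReal.ofReal (incVar μ (shiftedIncrement X u) (t - s + (s - u)) (s - u)) ≤
      worstIncVar μ (shiftedIncrement X u) (T - u) (t - s) :=
    le_iSup₂ (f := fun r (_ : r ∈ Icc (0 : ℝ) (T - u - (t - s))) =>
      ENNReal.ofReal (incVar μ (shiftedIncrement X u) (t - s + r) r)) (s - u)
      ⟨sub_nonneg.2 hus, by linarith⟩
  have h3 := (ENNReal.ofReal_le_ofReal_iff (by positivity)).1 (h2.trans h1)
  simpa [incVar, shiftedIncrement] using h3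

/-- Rescale [u, T] affinely to [0, 1]; the variance bound keeps its exponent and gains the factor (T
- u)^(2α). -/
theorem ClassX.ae_holder (hX : ClassX μ X α T) {u lam : ℝ} (hu : 0 ≤ u) (huT : u < T)
    (hcov : CovarianceConditions μ (shiftedIncrement X u) (T - u) α) (hlam : 0 < lam)
    (hlamα : lam < α) :
    ∀ᵐ ω ∂μ, ∃ C, 0 ≤ C ∧ ∀ s ∈ Icc u T, ∀ t ∈ Icc u T,
      |X s ω - X t ω| ≤ C * |s - t| ^ lam := by
  obtain ⟨C, hC, hCv⟩ := hcov.exists_integral_sq_le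
  have hTu : 0 < T - u := sub_pos.2 huT
  have hmem : ∀ x ∈ Icc (0 : ℝ) 1, u + (T - u) * x ∈ Icc u T := fun x hx =>
    ⟨by nlinarith [hx.1], by nlinarith [hx.2]⟩
  have hmem0 : ∀ x ∈ Icc (0 : ℝ) 1, u + (T - u) * x ∈ Icc 0 T := fun x hx =>
    ⟨hu.trans (hmem x hx).1, (hmem x hx).2⟩
  have key := ae_holder_of_gaussian_increments (μ := μ)
    (Y := fun x ω => X (u + (T - u) * x) ω) (C := C * (T - u) ^ (2 * α)) (α := α) (lam := lam)
    (fun s hs t ht => hX.hasGaussianLaw_sub (hmem0 s hs) (hmem0 t ht))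
    (fun s hs t ht => hX.integral_sub (hmem0 s hs) (hmem0 t ht)) (by
      filter_upwards [hX.continuous_paths] with ω hω
      exact hω.comp (by fun_prop) fun x hx => hmem0 x hx)
    (by positivity) hlam hlamα (fun s hs t ht hst => by
      refine (hCv _ _ (hmem s hs).1 (by gcongr) (hmem t ht).2).trans (le_of_eq ?_)
      rw [mul_assoc, ← Real.mul_rpow hTu.le (sub_nonneg.2 hst)]
      congr 2
      ring)
  filter_upwards [key] with ω ⟨K, hK, hω⟩
  refine ⟨K * ((T - u)⁻¹) ^ lam, by positivity, fun s hs t ht => ?_⟩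
  have hm : ∀ s ∈ Icc u T, (T - u)⁻¹ * (s - u) ∈ Icc (0 : ℝ) 1 := by
    intro s hs
    refine ⟨mul_nonneg (inv_nonneg.2 hTu.le) (sub_nonneg.2 hs.1), ?_⟩
    rw [inv_mul_le_one₀ hTu]
    linarith [hs.2]
  have e : ∀ s, u + (T - u) * ((T - u)⁻¹ * (s - u)) = s := fun s => by
    rw [mul_inv_cancel_left₀ hTu.ne']
    ring
  have := hω _ (hm s hs) _ (hm t ht)
  rw [e, e, ← mul_sub, abs_mul, abs_of_pos (inv_pos.2 hTu), sub_sub_sub_cancel_right,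
    Real.mul_rpow (inv_pos.2 hTu).le (abs_nonneg _), ← mul_assoc] at this
  exact this

/-- Positive variance makes the law atomless, so the mass of [-r, r] tends to that of {0}, which is
0. -/
theorem exists_measure_abs_lt_le {Z : Ω → ℝ} (hZ : HasGaussianLaw Z μ) (h0 : ∫ ω, Z ω ∂μ = 0)
    (hv : 0 < ∫ ω, Z ω ^ 2 ∂μ) {η : ENNReal} (hη : 0 < η) :
    ∃ ε > 0, μ {ω | |Z ω| < ε} ≤ η := by
  have := hZ.isProbabilityMeasure
  have hmap := hZ.map_eq_gaussianReal
  rw [h0, variance_of_integral_eq_zero hZ.aemeasurable h0] at hmap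
  have hna : NullSingletonClass (μ.map Z) := by
    rw [hmap]
    exact nullSingletonClass_gaussianReal (by simpa using hv)
  have : IsProbabilityMeasure (μ.map Z) := Measure.isProbabilityMeasure_map hZ.aemeasurable
  have hlim := tendsto_measure_biInter_gt (μ := μ.map Z) (s := fun r : ℝ => Icc (-r) r) (a := 0)
    (fun r _ => nullMeasurableSet_Icc)
    (fun i j _ hij => Icc_subset_Icc (neg_le_neg hij) hij) ⟨1, one_pos, measure_ne_top _ _⟩
  have hinter : ⋂ r > (0 : ℝ), Icc (-r) r = {0} := by
    ext x
    simp only [mem_iInter, ← abs_le, mem_Icc, mem_singleton_iff]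
    refine ⟨fun h => ?_, fun h r hr => by simp [h, le_of_lt hr]⟩
    by_contra hx
    have hx' := abs_pos.2 hx
    linarith [h (|x| / 2) (half_pos hx')]
  rw [hinter, measure_singleton] at hlim
  obtain ⟨ε, hε, hε0⟩ := ((hlim.eventually (gt_mem_nhds hη)).and self_mem_nhdsWithin).exists
  refine ⟨ε, hε0, le_trans ?_ hε.le⟩
  rw [Function.comp_apply, Measure.map_apply_of_aemeasurable hZ.aemeasurable measurableSet_Icc]
  exact measure_mono fun ω hω => abs_le.1 (le_of_lt hω)

/-- The positivity of the covariance, read on the diagonal. -/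
theorem CovarianceConditions.integral_sq_pos {u t : ℝ}
    (hcov : CovarianceConditions μ (shiftedIncrement X u) (T - u) α) (hut : u < t) (htT : t ≤ T) :
    0 < ∫ ω, (X t ω - X u ω) ^ 2 ∂μ := by
  have hm : t - u ∈ Ioc 0 (T - u) := ⟨sub_pos.2 hut, by linarith⟩
  have := hcov.cov_pos _ hm _ hm
  simpa [covFun, shiftedIncrement, sq] using this

/-- A random variable that is measurable with respect to the supremum of a filtration is an almost
sure limit of an adapted sequence. -/
theorem exists_adapted_tendsto [IsFiniteMeasure μ] (𝓖 : Filtration ℕ m) {ξ : Ω → ℝ}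
    (hξ : Measurable[⨆ n, 𝓖 n] ξ) :
    ∃ ζ : ℕ → Ω → ℝ, (∀ n, Measurable[𝓖 n] (ζ n)) ∧
      ∀ᵐ ω ∂μ, Tendsto (fun n => ζ n ω) atTop (𝓝 (ξ ω)) := by
  have hle : ⨆ n, 𝓖 n ≤ m := iSup_le 𝓖.le
  -- ξ need not be integrable; its arctangent is bounded, so Lévy's upward theorem applies to it.
  -- The tangent undoes this in the limit, being continuous at every value of arctan.
  set A : Ω → ℝ := fun ω => Real.arctan (ξ ω) with hA
  have hAm : Measurable[⨆ n, 𝓖 n] A := Real.measurable_arctan.comp hξ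
  have hAi : Integrable A μ := by
    refine Integrable.of_bound (hAm.mono hle le_rfl).aestronglyMeasurable (Real.pi / 2)
      (ae_of_all _ fun ω => ?_)
    exact abs_le.2 ⟨(Real.neg_pi_div_two_lt_arctan _).le, (Real.arctan_lt_pi_div_two _).le⟩
  refine ⟨fun n ω => Real.tan ((μ[A | 𝓖 n]) ω), fun n => ?_, ?_⟩
  · have : Measurable Real.tan := by
      have : Real.tan = fun x => Real.sin x / Real.cos x := by
        ext x
        exact Real.tan_eq_sin_div_cos x
      rw [this]
      fun_prop
    exact this.comp stronglyMeasurable_condExp.measurable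
  · filter_upwards [hAi.tendsto_ae_condExp hAm.stronglyMeasurable] with ω hω
    have hc : ContinuousAt Real.tan (A ω) :=
      Real.continuousAt_tan.2 (Real.cos_arctan_pos _).ne'
    have := hc.tendsto.comp hω
    rw [hA, Real.tan_arctan] at this
    exact this

/-- Left-continuity at T generates the terminal σ-algebra from earlier ones, and each time s < T is
passed by some τ n. -/
theorem exists_adapted_tendsto_of_leftContinuous [IsFiniteMeasure μ] (hT : 0 < T)
    {𝓕 : Filtration (Icc (0 : ℝ) T) m} (h𝓕 : LeftContinuous 𝓕) {τ : ℕ → ℝ} (hτ : Monotone τ)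
    (hτmem : ∀ n, τ n ∈ Icc 0 T) (hτlim : Tendsto τ atTop (𝓝 T)) {ξ : Ω → ℝ}
    (hξ : Measurable[𝓕 ⟨T, right_mem_Icc.mpr hT.le⟩] ξ) :
    ∃ ζ : ℕ → Ω → ℝ, (∀ n, Measurable[𝓕 ⟨τ n, hτmem n⟩] (ζ n)) ∧
      ∀ᵐ ω ∂μ, Tendsto (fun n => ζ n ω) atTop (𝓝 (ξ ω)) := by
  let 𝓖 : Filtration ℕ m := ⟨fun n => 𝓕 ⟨τ n, hτmem n⟩, fun i j hij =>
    𝓕.mono (Subtype.mk_le_mk.2 (hτ hij)), fun n => 𝓕.le _⟩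
  refine exists_adapted_tendsto 𝓖 (hξ.mono ?_ le_rfl)
  rw [h𝓕 ⟨T, right_mem_Icc.mpr hT.le⟩ hT]
  refine iSup₂_le fun s hs => ?_
  obtain ⟨n, hn⟩ := (hτlim.eventually (lt_mem_nhds (show (s : ℝ) < T from hs))).exists
  exact (𝓕.mono (show s ≤ ⟨τ n, hτmem n⟩ from hn.le)).trans (le_iSup (fun n => 𝓖 n) n)

/-! ### Adaptedness of the steering integrand -/

theorem measurable_steer {𝓕 : Filtration (Icc (0 : ℝ) T) m} {F : ℕ → ℝ → ℝ} {ζ : ℕ → Ω → ℝ}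
    (hF : ∀ n, Measurable (F n)) {τ : ℕ → ℝ} (hτ : Monotone τ) (hτmem : ∀ n, τ n ∈ Icc 0 T)
    (hX : ∀ t : Icc (0 : ℝ) T, Measurable[𝓕 t] (X t))
    (hζ : ∀ n, Measurable[𝓕 ⟨τ n, hτmem n⟩] (ζ n)) (n : ℕ) :
    Measurable[𝓕 ⟨τ n, hτmem n⟩]
      fun ω => steer F (fun k => ζ k ω) (fun k => X (τ k) ω) n := by
  induction n with
  | zero => exact measurable_const
  | succ n ih =>
    have hle : 𝓕 ⟨τ n, hτmem n⟩ ≤ 𝓕 ⟨τ (n + 1), hτmem (n + 1)⟩ :=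
      𝓕.mono (Subtype.mk_le_mk.2 (hτ n.le_succ))
    have h1 := ih.mono hle le_rfl
    have h2 := (hζ n).mono hle le_rfl
    have h3 := (hX ⟨τ n, hτmem n⟩).mono hle le_rfl
    exact h1.add ((h2.sub h1).mul ((hF n).comp ((hX ⟨τ (n + 1), hτmem (n + 1)⟩).sub h3)))

/-- At a time t in the k-th window the coefficient is known since τ k ≤ t, and the remaining factor
involves X only at t and τ k. -/
theorem stronglyAdapted_steeringIntegrand {𝓕 : Filtration (Icc (0 : ℝ) T) m} {F : ℕ → ℝ → ℝ}
    {ζ : ℕ → Ω → ℝ} (hF : ∀ n, Measurable (F n)) {τ : ℕ → ℝ} (hτ : Monotone τ)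
    (hτmem : ∀ n, τ n ∈ Ico 0 T) (hτlim : Tendsto τ atTop (𝓝 T))
    (hX : ∀ t : Icc (0 : ℝ) T, Measurable[𝓕 t] (X t))
    (hζ : ∀ n, Measurable[𝓕 ⟨τ n, Ico_subset_Icc_self (hτmem n)⟩] (ζ n)) :
    StronglyAdapted 𝓕 fun (t : Icc (0 : ℝ) T) ω =>
      steeringIntegrand F τ (fun k => ζ k ω) (fun r => X r ω) t := by
  intro t
  refine Measurable.stronglyMeasurable ?_
  rcases t.2.2.lt_or_eq with htT | htT
  · obtain ⟨N, hN⟩ := (hτlim.eventually (lt_mem_nhds htT)).exists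
    simp_rw [steeringIntegrand_eq_sum hτ hN]
    refine Finset.measurable_fun_sum _ fun k _ => ?_
    by_cases hk : (t : ℝ) ∈ Ico (τ k) (τ (k + 1))
    · simp_rw [indicator_of_mem hk]
      have hle : 𝓕 ⟨τ k, Ico_subset_Icc_self (hτmem k)⟩ ≤ 𝓕 t :=
        𝓕.mono (show (⟨τ k, Ico_subset_Icc_self (hτmem k)⟩ : Icc (0 : ℝ) T) ≤ t from hk.1)
      have h1 := (hζ k).mono hle le_rfl
      have h2 := (measurable_steer hF hτ (fun n => Ico_subset_Icc_self (hτmem n)) hX hζ k).mono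
        hle le_rfl
      have h3 := (hX ⟨τ k, Ico_subset_Icc_self (hτmem k)⟩).mono hle le_rfl
      exact (h1.sub h2).mul ((measurable_deriv (F k)).comp ((hX t).sub h3))
    · simp_rw [indicator_of_notMem hk]
      exact measurable_const
  · simp_rw [steeringIntegrand_of_le (fun n => (hτmem n).2) htT.ge]
    exact measurable_const

end Representation

end GaussRep

end

/-! ### Choice of the times, the exponents and the cutoffs -/

theorem theorem3p2 {Ω : Type*} {m : MeasurableSpace Ω} (μ : Measure Ω) [IsProbabilityMeasure μ]
    (T : ℝ) (hT : 0 < T) (α : ℝ) (hα : 1 / 2 < α) (hα' : α < 1)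
    (𝓕 : Filtration (Set.Icc (0 : ℝ) T) m) (h𝓕 : GaussRep.LeftContinuous 𝓕)
    (X : ℝ → Ω → ℝ) (hXadapted : StronglyAdapted 𝓕 (fun t : Set.Icc (0 : ℝ) T => X t))
    (hX : GaussRep.ClassX μ X α T) (hball : GaussRep.SmallBall μ X α T)
    (ξ : Ω → ℝ) (hξ : Measurable[𝓕 ⟨T, Set.right_mem_Icc.mpr hT.le⟩] ξ) :
    ∃ Ψ : ℝ → Ω → ℝ, StronglyAdapted 𝓕 (fun t : Set.Icc (0 : ℝ) T => Ψ t) ∧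
      ∃ β ∈ Set.Ioo (0 : ℝ) 1, ∀ᵐ ω ∂μ,
        (∀ s ∈ Set.Ico (0 : ℝ) T,
          GaussRep.GLSExists β (fun r => Ψ r ω) (fun r => X r ω) s) ∧
        Tendsto (fun s => GaussRep.glsIntegral β (fun r => Ψ r ω) (fun r => X r ω) s)
          (𝓝[<] T) (𝓝 (ξ ω)) := by
  obtain ⟨δ, hδ, hδT, hcov⟩ := hX.increments
  -- The times start at τ 0 = T - δ, so the covariance conditions are available from each of them.
  set τ : ℕ → ℝ := fun n => T - δ / ((n : ℝ) + 1) with hτdef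
  have hτ : StrictMono τ := by
    refine strictMono_nat_of_lt_succ fun n => sub_lt_sub_left ?_ T
    push_cast
    gcongr
    linarith
  have hτT : ∀ n, τ n < T := fun n => sub_lt_self T (by positivity)
  have hτ0 : τ 0 = T - δ := by simp [hτdef]
  have hτδ : ∀ n, T - δ ≤ τ n := fun n => hτ0 ▸ hτ.monotone (Nat.zero_le n)
  have hτmem : ∀ n, τ n ∈ Set.Ico 0 T := fun n => ⟨(sub_nonneg.2 hδT).trans (hτδ n), hτT n⟩
  have hτlim : Tendsto τ atTop (𝓝 T) := by
    have := (tendsto_const_div_atTop_nhds_zero_nat δ).comp (tendsto_add_atTop_nat 1)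
    have := this.const_sub T
    simpa [hτdef, Function.comp_def] using this
  -- Any Hölder order strictly between 1/2 and α exceeds both β and 1 - β for β = 1/2.
  obtain ⟨lam, hlam, hlamα⟩ := exists_between hα
  have hXm : ∀ t : Set.Icc (0 : ℝ) T, Measurable[𝓕 t] (X t) := fun t => (hXadapted t).measurable
  obtain ⟨ζ, hζ, hζlim⟩ := GaussRep.exists_adapted_tendsto_of_leftContinuous (μ := μ) hT h𝓕
    hτ.monotone (fun n => Set.Ico_subset_Icc_self (hτmem n)) hτlim hξ
  -- The thresholds depend only on the laws of the increments, so the functions F n are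
  -- deterministic and do not disturb adaptedness.
  have hε : ∀ n : ℕ, ∃ ε > 0,
      μ {ω | |X (τ (n + 1)) ω - X (τ n) ω| < ε} ≤ (2 : ENNReal)⁻¹ ^ n := fun n =>
    GaussRep.exists_measure_abs_lt_le
      (hX.hasGaussianLaw_sub (Set.Ico_subset_Icc_self (hτmem n))
        (Set.Ico_subset_Icc_self (hτmem (n + 1))))
      (hX.integral_sub (Set.Ico_subset_Icc_self (hτmem n))
        (Set.Ico_subset_Icc_self (hτmem (n + 1))))
      ((hcov _ ⟨hτδ n, hτT n⟩).integral_sq_pos (hτ n.lt_succ_self) (hτT _).le)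
      (ENNReal.pow_pos (by simp) n)
  choose ε hε0 hεμ using hε
  have hsum : ∑' n, μ {ω | |X (τ (n + 1)) ω - X (τ n) ω| < ε n} ≠ ⊤ := by
    refine ne_top_of_le_ne_top ?_ (ENNReal.tsum_le_tsum hεμ)
    rw [ENNReal.tsum_geometric]
    simp
  set F : ℕ → ℝ → ℝ := fun n => GaussRep.cutoff (ε n) with hFdef
  have hF : ∀ n, ContDiff ℝ 2 (F n) := fun n => GaussRep.contDiff_cutoff _
  refine ⟨fun r ω => GaussRep.steeringIntegrand F τ (fun k => ζ k ω) (fun r => X r ω) r,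
    GaussRep.stronglyAdapted_steeringIntegrand (fun n => (hF n).continuous.measurable)
      hτ.monotone hτmem hτlim hXm hζ, 1 / 2, ⟨by norm_num, by norm_num⟩, ?_⟩
  filter_upwards [ae_eventually_notMem hsum, hζlim,
    hX.ae_holder (hτmem 0).1 (hτT 0) (hcov _ ⟨hτδ 0, hτT 0⟩) (by linarith) hlamα]
    with ω hhit hlim ⟨C, hC, hhol⟩
  refine ⟨fun s hs => (GaussRep.steeringIntegrand_glsExists_and_eq hF hτ hτT hτlim (hτmem 0).1
    (by norm_num) (by norm_num) (hlamα.trans hα') hlam (by linarith) hC hhol hs).1, ?_⟩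
  refine GaussRep.tendsto_glsIntegral_steeringIntegrand hF (fun n => GaussRep.cutoff_zero _)
    (fun n x => ⟨GaussRep.cutoff_nonneg _ _, GaussRep.cutoff_le_one _ _⟩) hτ hτT hτlim (hτmem 0).1
    (by norm_num) (by norm_num) (hlamα.trans hα') hlam (by linarith) hC hhol ?_ hlim
  filter_upwards [hhit] with n hn
  exact GaussRep.cutoff_of_le (hε0 n) (not_lt.1 hn)
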